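/- There is a universal constant $C>0$ such that the following holds. Setting. Let $\mathcal X\subset\mathbb R^n$, $\mathcal Y\subset\mathbb R^m$ be non-empty, convex and compact, $d=\max\{n,m\}$, and let $D$ be the larger of the diameters of $\mathcal X$ and $\mathcal Y$ (Euclidean norms throughout). Let $f:\mathcal X\times\mathcal Y\to\mathbb R$ have partial gradients $\nabla_xf,\nabla_yf$ with, for all $x_1,x_2\in\mathcal X$, $y_1,y_2\in\mathcal Y$ and some $L,\mu>0$, $$\|\nabla_x f(x_1,y_1)-\nabla_xf(x_2,y_2)\|\le L(\|x_1-x_2\|+\|y_1-y_2\|),\qquad \|\nabla_y f(x_1,y_1)-\nabla_yf(x_2,y_2)\|\le L(\|x_1-x_2\|+\|y_1-y_2\|),$$ $$f(x_2,y_1)\ge f(x_1,y_1)+\langle\nabla_xf(x_1,y_1),x_2-x_1\rangle+\tfrac\mu2\|x_2-x_1\|^2,\qquad f(x_1,y_2)\le f(x_1,y_1)+\langle\nabla_yf(x_1,y_1),y_2-y_1\rangle-\tfrac\mu2\|y_2-y_1\|^2 .$$ Let $z^*=(x^*,y^*)\in\mathcal X\times\mathcal Y$ be a saddle point: $f(x^*,y)\le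 f(x^*,y^*)\le f(x,y^*)$ for all $x\in\mathcal X$, $y\in\mathcal Y$. For $\xi\sim\mathcal D$ let $g_x(x,y;\xi)$, $g_y(x,y;\xi)$ be unbiased estimates of $\nabla_xf(x,y)$, $\nabla_yf(x,y)$ for all $(x,y)\in\mathcal X\times\mathcal Y$, with the variances of the coordinates bounded by $\sigma_x^2(j)$, $j\le n$, and $\sigma_y^2(k)$, $k\le m$; put $\sigma=\max\{(\sum_j\sigma_x^2(j))^{1/2},(\sum_k\sigma_y^2(k))^{1/2}\}$. Algorithm (RDEG). There are $M$ agents ($M$ even), at most $\alpha M$ of which, a fixed set, are Byzantine. Let $T\ge1$, $\delta=1/(4dT^2)$ and $\epsilon=8\alpha+24\log(4/\delta)/M$. For scalars $Z_1,\dots,Z_M$ the trimmed mean is $\frac2M\sum_{i>M/2}\phi_{\gamma,\beta}(Z_i)$, where $\phi_{\gamma,\beta}$ truncates to $[\gamma,\beta]$, and $\gamma$, $\beta$ are the entries with ranks $\lceil\epsilon M/2\rceil$ and $\lceil(1-\epsilon)M/2\rceil$ in the non-decreasing arrangement of $Z_1,\dots,Z_{M/2}$; $\mathrm{Trim}_\epsilon$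 of $M$ vectors is the coordinatewise trimmed mean. A query at a point $w\in\mathcal X\times\mathcal Y$ returns robust gradients $\tilde g_x(w),\tilde g_y(w)$, obtained by applying $\mathrm{Trim}_\epsilon$ to $M$ vectors: each normal agent draws a fresh independent sample $\xi\sim\mathcal D$ and sends $g_x(w;\xi),g_y(w;\xi)$, while the Byzantine agents send arbitrary vectors, which may depend on the entire past, on the current samples of all normal agents, on each other and on additional randomness independent of future samples. From $z_1=(x_1,y_1)\in\mathcal X\times\mathcal Y$, for $t=1,\dots,T$, with Euclidean projections $\Pi$ and step-size $\eta>0$, $$\hat z_t=\big(\Pi_{\mathcal X}(x_t-\eta\tilde g_x(z_t)),\,\Pi_{\mathcal Y}(y_t+\eta\tilde g_y(z_t))\big),\qquad z_{t+1}=\big(\Pi_{\mathcal X}(x_t-\eta\tilde g_x(\hat z_t)),\,\Pi_{\mathcal Y}(y_t+\eta\tilde g_y(\hat z_t))\big).$$ Claim. Suppose $\alpha\in[0,1/16)$, $M\ge48\log(16dT^2)$, $\epsilon\le1/2$ (so that the lower truncation level never exceeds the upper one), and $0<\eta\le1/(4L)$. With $\kappa=L/\mu$, with probability at least $1-1/T$,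 $$\|z^*-z_{T+1}\|^2\le 2e^{-\eta\mu T}D^2+C\,\frac{\sigma D\kappa}{L}\left(\sqrt\alpha+\sqrt{\frac{\log(4dT^2)}{M}}\right).$$ In particular, for $\eta=1/(4L)$, with probability at least $1-1/T$, $$\|z^*-z_{T+1}\|^2\le 2e^{-T/(4\kappa)}D^2+C\,\frac{\sigma D\kappa}{L}\left(\sqrt\alpha+\sqrt{\frac{\log(4dT^2)}{M}}\right).$$ -/

import Mathlib

open MeasureTheory ProbabilityTheory

noncomputable section

namespace RDEG

/-- Vectors of `ℝⁿ` with the Euclidean norm. -/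
abbrev Vec (n : ℕ) : Type := EuclideanSpace ℝ (Fin n)

/-! ### The univariate trimmed-mean estimator -/

/-- The `k`-th smallest entry (with `k = 1, …, N`) of `Z`, counted with multiplicity;
the value is `0` for `k` outside `1, …, N`. -/
def orderStat {N : ℕ} (Z : Fin N → ℝ) (k : ℕ) : ℝ :=
  if h : 1 ≤ k ∧ k ≤ N then Z (Tuple.sort Z ⟨k - 1, by omega⟩) else 0

/-- The empirical quantile `Z*_{pN}` of `Z` at level `p`; a fractional index `pN` is rounded up. -/
def quantile {N : ℕ} (p : ℝ) (Z : Fin N → ℝ) : ℝ :=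
  orderStat Z ⌈p * N⌉₊

/-- The truncation `φ_{γ,β}`. -/
def truncate (γ β x : ℝ) : ℝ :=
  if β < x then β else if x < γ then γ else x

/-- The first half of a data set of size `M`. -/
def firstHalf {M : ℕ} (Z : Fin M → ℝ) : Fin (M / 2) → ℝ :=
  fun i => Z ⟨i, by omega⟩

/-- The second half of a data set of (even) size `M`. -/
def secondHalf {M : ℕ} (Z : Fin M → ℝ) : Fin (M / 2) → ℝ :=
  fun i => Z ⟨M / 2 + i, by omega⟩

/-- The trimmed mean with trimming parameter `ε`: the first half of the data gives the truncation
levels, the truncated second half is averaged. -/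
def trimmedMean {M : ℕ} (ε : ℝ) (Z : Fin M → ℝ) : ℝ :=
  (2 / (M : ℝ)) * ∑ i, truncate (quantile ε (firstHalf Z)) (quantile (1 - ε) (firstHalf Z))
    (secondHalf Z i)

/-- The trimming parameter for corruption fraction `α`, confidence level `δ` and `M` data points. -/
def trimParam (α δ : ℝ) (M : ℕ) : ℝ :=
  8 * α + 24 * (Real.log (4 / δ) / M)

/-- The operator `Trim_ε`: the trimmed mean of `M` vectors, coordinate by coordinate. -/
def trim {M n : ℕ} (ε : ℝ) (V : Fin M → Vec n) : Vec n :=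
  WithLp.toLp 2 fun j => trimmedMean ε fun i => V i j

/-! ### The algorithm -/

/-- Euclidean projection on `X`: a point of `X` nearest to `v` (it exists and is unique when `X` is
non-empty, closed and convex). -/
def proj {n : ℕ} (X : Set (Vec n)) (v : Vec n) : Vec n :=
  Classical.epsilon fun p => p ∈ X ∧ ∀ q ∈ X, ‖v - p‖ ≤ ‖v - q‖

/-- The vectors that the server receives: a normal agent `i` sends its stochastic gradient
`g x y (ξ i)`, an agent `i` in the Byzantine set `B` sends an arbitrary vector `b i`. -/
def received {n m k M : ℕ} {Ξ : Type*} (B : Finset (Fin M)) (g : Vec n → Vec m → Ξ → Vec k)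
    (x : Vec n) (y : Vec m) (ξ : Fin M → Ξ) (b : Fin M → Vec k) : Fin M → Vec k :=
  fun i => if i ∈ B then b i else g x y (ξ i)

/-- One projected primal-dual update from the base point `z`, with robust gradients at the query
point `w`; `ξ` are the samples and `b` the Byzantine messages of this communication round. -/
def update {n m M : ℕ} {Ξ : Type*} (X : Set (Vec n)) (Y : Set (Vec m)) (η ε : ℝ)
    (B : Finset (Fin M)) (gx : Vec n → Vec m → Ξ → Vec n) (gy : Vec n → Vec m → Ξ → Vec m)
    (z w : Vec n × Vec m) (ξ : Fin M → Ξ) (b : Fin M → Vec n × Vec m) : Vec n × Vec m :=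
  (proj X (z.1 - η • trim ε (received B gx w.1 w.2 ξ fun i => (b i).1)),
    proj Y (z.2 + η • trim ε (received B gy w.1 w.2 ξ fun i => (b i).2)))

/-- The iterates of robust distributed extra-gradient: `iterate … t` is `z_{t+1} = (x_{t+1}, y_{t+1})`,
so `iterate … 0` is the initial point. The iteration from `z_{t+1}` to `z_{t+2}` uses
communication round `2t` (gradients at the current iterate) and
round `2t+1` (gradients at the mid-point). -/
def iterate {n m M : ℕ} {Ξ : Type*} (X : Set (Vec n)) (Y : Set (Vec m)) (η ε : ℝ)
    (B : Finset (Fin M)) (gx : Vec n → Vec m → Ξ → Vec n) (gy : Vec n → Vec m → Ξ → Vec m)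
    (z₁ : Vec n × Vec m) (ξ : ℕ → Fin M → Ξ) (b : ℕ → Fin M → Vec n × Vec m) :
    ℕ → Vec n × Vec m
  | 0 => z₁
  | t + 1 =>
    let z := iterate X Y η ε B gx gy z₁ ξ b t
    let zmid := update X Y η ε B gx gy z z (ξ (2 * t)) (b (2 * t))
    update X Y η ε B gx gy z zmid (ξ (2 * t + 1)) (b (2 * t + 1))

/-! ### The objective -/

/-- `Gx` and `Gy` are the partial gradients of `f` on `X × Y`. -/
def ArePartialGradients {n m : ℕ} (X : Set (Vec n)) (Y : Set (Vec m)) (f : Vec n → Vec m → ℝ)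
    (Gx : Vec n → Vec m → Vec n) (Gy : Vec n → Vec m → Vec m) : Prop :=
  ∀ x ∈ X, ∀ y ∈ Y, HasGradientWithinAt (fun x' => f x' y) (Gx x y) X x ∧
    HasGradientWithinAt (fun y' => f x y') (Gy x y) Y y

/-- Smoothness with constant `L`, for the partial gradients `Gx` and `Gy`. -/
def AreSmooth {n m : ℕ} (X : Set (Vec n)) (Y : Set (Vec m)) (L : ℝ)
    (Gx : Vec n → Vec m → Vec n) (Gy : Vec n → Vec m → Vec m) : Prop :=
  ∀ x₁ ∈ X, ∀ x₂ ∈ X, ∀ y₁ ∈ Y, ∀ y₂ ∈ Y,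
    ‖Gx x₁ y₁ - Gx x₂ y₂‖ ≤ L * (‖x₁ - x₂‖ + ‖y₁ - y₂‖) ∧
    ‖Gy x₁ y₁ - Gy x₂ y₂‖ ≤ L * (‖x₁ - x₂‖ + ‖y₁ - y₂‖)

/-- `f`, with partial gradients `Gx` and `Gy`, is `μ`-strongly convex-`μ`-strongly concave. -/
def IsStronglyConvexConcave {n m : ℕ} (X : Set (Vec n)) (Y : Set (Vec m)) (μ : ℝ)
    (f : Vec n → Vec m → ℝ) (Gx : Vec n → Vec m → Vec n) (Gy : Vec n → Vec m → Vec m) : Prop :=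
  ∀ x₁ ∈ X, ∀ x₂ ∈ X, ∀ y₁ ∈ Y, ∀ y₂ ∈ Y,
    f x₁ y₁ + inner ℝ (Gx x₁ y₁) (x₂ - x₁) + μ / 2 * ‖x₂ - x₁‖ ^ 2 ≤ f x₂ y₁ ∧
    f x₁ y₂ ≤ f x₁ y₁ + inner ℝ (Gy x₁ y₁) (y₂ - y₁) - μ / 2 * ‖y₂ - y₁‖ ^ 2

/-! ### The stochastic model -/

/-- The stochastic oracle `g` is unbiased for `G` over `X × Y`, and the variance of its `j`-th
coordinate is at most `σ j ^ 2`. -/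
structure IsStochasticOracle {n m k : ℕ} {Ξ : Type*} [MeasurableSpace Ξ] (D : Measure Ξ)
    (X : Set (Vec n)) (Y : Set (Vec m)) (G : Vec n → Vec m → Vec k)
    (g : Vec n → Vec m → Ξ → Vec k) (σ : Fin k → ℝ) : Prop where
  measurable : Measurable fun p : Vec n × Vec m × Ξ => g p.1 p.2.1 p.2.2
  memLp : ∀ x ∈ X, ∀ y ∈ Y, ∀ j, MemLp (fun s => g x y s j) 2 D
  unbiased : ∀ x ∈ X, ∀ y ∈ Y, ∀ j, ∫ s, g x y s j ∂D = G x y j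
  variance_le : ∀ x ∈ X, ∀ y ∈ Y, ∀ j, ∫ s, (g x y s j - G x y j) ^ 2 ∂D ≤ σ j ^ 2

/-- The randomness of the first `R` communication rounds, with Byzantine set `B`.
The σ-algebra `ℱ r` is all that is known before round `r`. The samples that the normal agents draw
in round `r` are independent of `ℱ r`, independent of each other, and have law `D`.
The Byzantine messages of round `r` are arbitrary functions of all that is known after the
samples of round `r` have been drawn: they may depend on the past, on the current
samples of the normal agents, on each other and on additional randomness. -/
structure IsByzantineExecution {n m M : ℕ} {Ξ Ω : Type*} [MeasurableSpace Ξ]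
    [mΩ : MeasurableSpace Ω] (P : Measure Ω) (D : Measure Ξ) (B : Finset (Fin M)) (R : ℕ)
    (ℱ : Filtration ℕ mΩ) (ξ : ℕ → Fin M → Ω → Ξ) (b : ℕ → Fin M → Ω → Vec n × Vec m) :
    Prop where
  sample_measurable : ∀ r < R, ∀ i ∉ B, Measurable[ℱ (r + 1)] (ξ r i)
  message_measurable : ∀ r < R, ∀ i ∈ B, Measurable[ℱ (r + 1)] (b r i)
  sample_law : ∀ r < R, ∀ i ∉ B, P.map (ξ r i) = D
  sample_indep : ∀ r < R, iIndepFun (fun i : {i : Fin M // i ∉ B} => ξ r i) P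
  sample_fresh : ∀ r < R, Indep (ℱ r)
    (MeasurableSpace.comap (fun ω (i : {i : Fin M // i ∉ B}) => ξ r i ω) inferInstance) P

/-- The aggregate noise level `σ = max {σ_x, σ_y}`, where `σ_x² = ∑ j, σ_x(j)²`, and likewise
for `σ_y`. -/
def noiseLevel {n m : ℕ} (σx : Fin n → ℝ) (σy : Fin m → ℝ) : ℝ :=
  max (Real.sqrt (∑ j, σx j ^ 2)) (Real.sqrt (∑ k, σy k ^ 2))

/-- The error floor `(σ D κ / L) (√α + √(log (4 d T²) / M))`. -/
def errorFloor (σ D κ L α : ℝ) (d T M : ℕ) : ℝ :=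
  σ * D * κ / L * (Real.sqrt α + Real.sqrt (Real.log (4 * d * T ^ 2) / M))

end RDEG

end

/-!
The proof separates a deterministic analysis of the extra-gradient method with inexact gradients
from a high-probability bound on the error of the robust gradients.

*Trimmed mean.* For real data whose normal entries are independent with mean `m` and variance at
most `s²`, the trimmed mean is within `64 s √ε` of `m` with probability `1 - δ`, against every
corruption (`RDEG.measure_trimmedMean_dev_le`). Chebyshev's inequality keeps both truncation levels
within `U = 4 s / √ε` of `m`, which suffices when `ε` is bounded below. For small `ε` there is a
level `a` such that truncating the centred law from below at `a` moves its mean by exactly `4 s √ε`;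
by Cauchy-Schwarz it has mass at least `8ε` below it, so with high probability the lower
truncation level does not exceed `m + a`. The truncated mean is monotone in the truncation levels,
hence it is bounded by the average of the fixed function `x ↦ max a (min U (x - m))` of the
second half, and no independence between the two halves is needed although the corrupted entries may
tie them together. Bernstein-type bounds (`RDEG.measure_le_sum_le_exp`) control this average and the
counts of entries beyond `U` and `a`; the few corrupted entries contribute at most `U` each.
The other side follows by changing signs.

*Random query points.* The query point of a round is independent of the fresh samples, so Fubini's
theorem transfers the bound from fixed query points to random ones
(`RDEG.IsStochasticOracle.measure_dev_le`). The supremum over corruptions is taken over rational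
messages only, which keeps the exceptional set measurable. A union bound over the `2T` rounds and
`n + m` coordinates costs `2T(n+m)δ ≤ 1/T`.

*Optimization.* If all robust gradients are accurate up to `Δ`, an extra-gradient step contracts the
squared distance to the saddle point by the factor `1 - ημ` up to an error `12 η Δ D`
(`RDEG.extragradient_step`), so that the errors add up to at most `12 Δ D / μ`.
-/

namespace RDEG

/-! ### Order statistics and quantiles -/

lemma orderStat_le_iff {N : ℕ} (Z : Fin N → ℝ) {k : ℕ} (hk : 1 ≤ k) (hkN : k ≤ N) (c : ℝ) :
    orderStat Z k ≤ c ↔ k ≤ (Finset.univ.filter fun i => Z i ≤ c).card := by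
  have h := Tuple.lt_card_le_iff_apply_le_of_monotone (f := Z ∘ Tuple.sort Z)
    (j := ⟨k - 1, by omega⟩) (a := c) (Tuple.monotone_sort Z)
  have hcard : (Finset.univ.filter fun i => (Z ∘ Tuple.sort Z) i ≤ c).card =
      (Finset.univ.filter fun i => Z i ≤ c).card := by
    rw [← Fintype.card_subtype, ← Fintype.card_subtype]
    exact Fintype.card_congr ((Tuple.sort Z).subtypeEquiv fun _ => Iff.rfl)
  rw [hcard] at h
  rw [orderStat, dif_pos ⟨hk, hkN⟩]
  exact h.symm.trans (by simp only; omega)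

lemma le_orderStat {N : ℕ} (Z : Fin N → ℝ) {k : ℕ} (hk : 1 ≤ k) (hkN : k ≤ N) {c : ℝ}
    (h : N < k + (Finset.univ.filter fun i => c ≤ Z i).card) : c ≤ orderStat Z k := by
  by_contra! hlt
  have h₁ := (orderStat_le_iff Z hk hkN _).1 (le_refl (orderStat Z k))
  have h₂ : (Finset.univ.filter fun i => Z i ≤ orderStat Z k).card ≤
      (Finset.univ.filter fun i => ¬ c ≤ Z i).card :=
    Finset.card_le_card fun i hi => by
      simp only [Finset.mem_filter, Finset.mem_univ, true_and, not_le] at hi ⊢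
      exact hi.trans_lt hlt
  have h₃ := Finset.card_filter_add_card_filter_not (s := Finset.univ) (fun i => c ≤ Z i)
  simp only [Finset.card_univ, Fintype.card_fin] at h₃
  omega

lemma orderStat_of_not {N : ℕ} (Z : Fin N → ℝ) {k : ℕ} (h : ¬ (1 ≤ k ∧ k ≤ N)) :
    orderStat Z k = 0 := dif_neg h

lemma orderStat_mono {N : ℕ} {Z Z' : Fin N → ℝ} (h : Z ≤ Z') (k : ℕ) :
    orderStat Z k ≤ orderStat Z' k := by
  by_cases hk : 1 ≤ k ∧ k ≤ N
  · rw [orderStat_le_iff Z hk.1 hk.2]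
    refine ((orderStat_le_iff Z' hk.1 hk.2 _).1 le_rfl).trans (Finset.card_le_card fun i hi => ?_)
    simp only [Finset.mem_filter, Finset.mem_univ, true_and] at hi ⊢
    exact (h i).trans hi
  · rw [orderStat_of_not _ hk, orderStat_of_not _ hk]

lemma orderStat_mono_right {N : ℕ} (Z : Fin N → ℝ) {k l : ℕ} (hk : 1 ≤ k) (hkl : k ≤ l)
    (hl : l ≤ N) : orderStat Z k ≤ orderStat Z l :=
  (orderStat_le_iff Z hk (hkl.trans hl) _).2
    (hkl.trans ((orderStat_le_iff Z (hk.trans hkl) hl _).1 le_rfl))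

@[fun_prop]
lemma measurable_orderStat {N : ℕ} (k : ℕ) :
    Measurable fun Z : Fin N → ℝ => orderStat Z k := by
  by_cases hk : 1 ≤ k ∧ k ≤ N
  · refine measurable_of_Iic fun c => ?_
    have : (fun Z : Fin N → ℝ => orderStat Z k) ⁻¹' Set.Iic c =
        {Z | (k : ℝ) ≤ ∑ i, if Z i ≤ c then (1 : ℝ) else 0} := by
      ext Z
      simp only [Set.mem_preimage, Set.mem_Iic, Set.mem_ofPred_eq, orderStat_le_iff Z hk.1 hk.2,
        Finset.sum_boole, Nat.cast_le]
    rw [this]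
    refine measurableSet_le measurable_const (Finset.measurable_sum _ fun i _ => ?_)
    exact Measurable.ite (measurableSet_le (measurable_pi_apply i) measurable_const)
      measurable_const measurable_const
  · simp only [orderStat_of_not _ hk]
    exact measurable_const

lemma quantile_mono {N : ℕ} {Z Z' : Fin N → ℝ} (h : Z ≤ Z') (p : ℝ) :
    quantile p Z ≤ quantile p Z' := orderStat_mono h _

lemma one_le_ceil_and_ceil_le {N : ℕ} (hN : 0 < N) {p : ℝ} (hp : 0 < p) (hp1 : p ≤ 1) :
    1 ≤ ⌈p * N⌉₊ ∧ ⌈p * N⌉₊ ≤ N := by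
  have hN' : (0 : ℝ) < N := by exact_mod_cast hN
  exact ⟨Nat.one_le_ceil_iff.2 (by positivity), Nat.ceil_le.2 (by nlinarith)⟩

lemma quantile_le_quantile {N : ℕ} (Z : Fin N → ℝ) (hN : 0 < N) {p q : ℝ} (hp : 0 < p)
    (hpq : p ≤ q) (hq : q ≤ 1) : quantile p Z ≤ quantile q Z :=
  orderStat_mono_right Z (one_le_ceil_and_ceil_le hN hp (hpq.trans hq)).1
    (Nat.ceil_mono (by gcongr)) (one_le_ceil_and_ceil_le hN (hp.trans_le hpq) hq).2

lemma quantile_le {N : ℕ} (Z : Fin N → ℝ) (hN : 0 < N) {p c : ℝ} (hp : 0 < p) (hp1 : p ≤ 1)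
    (h : p * N ≤ (Finset.univ.filter fun i => Z i ≤ c).card) : quantile p Z ≤ c := by
  obtain ⟨h₁, h₂⟩ := one_le_ceil_and_ceil_le hN hp hp1
  exact (orderStat_le_iff Z h₁ h₂ c).2 (Nat.ceil_le.2 h)

lemma le_quantile {N : ℕ} (Z : Fin N → ℝ) (hN : 0 < N) {p c : ℝ} (hp : 0 < p) (hp1 : p ≤ 1)
    (h : N < p * N + (Finset.univ.filter fun i => c ≤ Z i).card) : c ≤ quantile p Z := by
  obtain ⟨h₁, h₂⟩ := one_le_ceil_and_ceil_le hN hp hp1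
  refine le_orderStat Z h₁ h₂ ?_
  have := Nat.le_ceil (p * N)
  have h' : (N : ℝ) < ⌈p * N⌉₊ + (Finset.univ.filter fun i => c ≤ Z i).card := by linarith
  exact_mod_cast h'

/-! ### The trimmed mean as a function of the data -/

lemma truncate_eq {γ β : ℝ} (h : γ ≤ β) (x : ℝ) : truncate γ β x = max γ (min β x) := by
  unfold truncate
  split_ifs with h₁ h₂
  · rw [min_eq_left h₁.le, max_eq_right h]
  · rw [min_eq_right (by linarith), max_eq_left h₂.le]
  · rw [min_eq_right (by linarith), max_eq_right (by linarith)]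

lemma firstHalf_quantile_le {M : ℕ} (hN : 0 < M / 2) {ε : ℝ} (hε : 0 < ε) (hε2 : ε ≤ 1 / 2)
    (Z : Fin M → ℝ) : quantile ε (firstHalf Z) ≤ quantile (1 - ε) (firstHalf Z) :=
  quantile_le_quantile _ hN hε (by linarith) (by linarith)

/-- The trimmed mean is monotone in the data: raising a corrupted entry only moves the estimate up,
so that countably many corruptions suffice to realize the worst case. -/
lemma trimmedMean_mono {M : ℕ} {ε : ℝ} (hε : 0 < ε) (hε2 : ε ≤ 1 / 2) {Z Z' : Fin M → ℝ}
    (h : Z ≤ Z') : trimmedMean ε Z ≤ trimmedMean ε Z' := by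
  unfold trimmedMean
  refine mul_le_mul_of_nonneg_left (Finset.sum_le_sum fun i _ => ?_) (by positivity)
  have hN : 0 < M / 2 := i.pos
  rw [truncate_eq (firstHalf_quantile_le hN hε hε2 _),
    truncate_eq (firstHalf_quantile_le hN hε hε2 _)]
  have h₁ : firstHalf Z ≤ firstHalf Z' := fun i => h _
  exact max_le_max (quantile_mono h₁ _) (min_le_min (quantile_mono h₁ _) (h _))

@[fun_prop]
lemma measurable_trimmedMean {M : ℕ} (ε : ℝ) :
    Measurable fun Z : Fin M → ℝ => trimmedMean ε Z := by
  have hf : Measurable fun Z : Fin M → ℝ => firstHalf Z :=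
    measurable_pi_lambda _ fun i => measurable_pi_apply _
  have hq : ∀ p : ℝ, Measurable fun Z : Fin M → ℝ => quantile p (firstHalf Z) :=
    fun p => (measurable_orderStat _).comp hf
  unfold trimmedMean truncate
  refine measurable_const.mul (Finset.measurable_sum _ fun i _ => ?_)
  have hs : Measurable fun Z : Fin M → ℝ => secondHalf Z i := measurable_pi_apply _
  exact Measurable.ite (measurableSet_lt (hq _) hs) (hq _)
    (Measurable.ite (measurableSet_lt hs (hq _)) (hq _) hs)

lemma card_firstHalf {M : ℕ} (p : ℝ → Prop) [DecidablePred p] (Z : Fin M → ℝ) :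
    (Finset.univ.filter fun i => p (firstHalf Z i)).card =
      (Finset.univ.filter fun i : Fin M => i.val < M / 2 ∧ p (Z i)).card := by
  refine Finset.card_bij (fun i _ => ⟨i.val, by omega⟩) ?_ ?_ ?_
  · intro i hi
    exact Finset.mem_filter.2 ⟨Finset.mem_univ _, i.isLt, (Finset.mem_filter.1 hi).2⟩
  · intro i _ j _ h
    simpa [Fin.ext_iff] using h
  · intro i hi
    simp only [Finset.mem_filter, Finset.mem_univ, true_and] at hi
    exact ⟨⟨i.val, hi.1⟩, Finset.mem_filter.2 ⟨Finset.mem_univ _, hi.2⟩, rfl⟩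

lemma sum_secondHalf {M : ℕ} (hM : Even M) (F : ℝ → ℝ) (Z : Fin M → ℝ) :
    ∑ i, F (secondHalf Z i) = ∑ i : Fin M with M / 2 ≤ i.val, F (Z i) := by
  obtain ⟨N, rfl⟩ := hM
  refine Finset.sum_bij (fun i _ => ⟨(N + N) / 2 + i.val, by omega⟩) ?_ ?_ ?_ ?_
  · intro i _
    simp
  · intro i _ j _ h
    simpa [Fin.ext_iff] using h
  · intro i hi
    simp only [Finset.mem_filter, Finset.mem_univ, true_and] at hi
    exact ⟨⟨i.val - (N + N) / 2, by omega⟩, Finset.mem_univ _, by ext; simp; omega⟩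
  · intro i _
    rfl

/-- Upper bounds `m + a` and `m + U` on the two truncation levels bound the error by an average of a
fixed function of the second half, which no longer depends on the first half. -/
lemma trimmedMean_sub_le {M : ℕ} (hM : Even M) (hM0 : 0 < M) {ε : ℝ} (hε : 0 < ε)
    (hε2 : ε ≤ 1 / 2) (Z : Fin M → ℝ) {m a U : ℝ}
    (hγ : quantile ε (firstHalf Z) ≤ m + a) (hβ : quantile (1 - ε) (firstHalf Z) ≤ m + U) :
    trimmedMean ε Z - m ≤
      (2 / M : ℝ) * ∑ i : Fin M with M / 2 ≤ i.val, max a (min U (Z i - m)) := by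
  have hM' : (0 : ℝ) < M := by exact_mod_cast hM0
  have hN : 0 < M / 2 := by obtain ⟨N, rfl⟩ := hM; omega
  have hcast : ((M / 2 : ℕ) : ℝ) = M / 2 := by
    rw [Nat.cast_div hM.two_dvd two_ne_zero, Nat.cast_ofNat]
  have key : trimmedMean ε Z ≤ (2 / M : ℝ) * ∑ i, (max a (min U (secondHalf Z i - m)) + m) := by
    unfold trimmedMean
    refine mul_le_mul_of_nonneg_left (Finset.sum_le_sum fun i _ => ?_) (by positivity)
    rw [truncate_eq (firstHalf_quantile_le hN hε hε2 _), ← max_add_add_right,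
      ← min_add_add_right, sub_add_cancel]
    exact max_le_max (by linarith) (min_le_min (by linarith) le_rfl)
  rw [Finset.sum_add_distrib, sum_secondHalf hM (fun x => max a (min U (x - m)))] at key
  simp only [Finset.sum_const, Finset.card_univ, Fintype.card_fin, nsmul_eq_mul, hcast] at key
  have : (2 / M : ℝ) * (M / 2 * m) = m := by field_simp
  linarith

/-- The lower counterpart of `trimmedMean_sub_le`: the roles of the two truncation levels are
exchanged. -/
lemma sub_trimmedMean_le {M : ℕ} (hM : Even M) (hM0 : 0 < M) {ε : ℝ} (hε : 0 < ε)
    (hε2 : ε ≤ 1 / 2) (Z : Fin M → ℝ) {m a U : ℝ}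
    (hγ : m - U ≤ quantile ε (firstHalf Z)) (hβ : m - a ≤ quantile (1 - ε) (firstHalf Z)) :
    m - trimmedMean ε Z ≤
      (2 / M : ℝ) * ∑ i : Fin M with M / 2 ≤ i.val, max a (min U (m - Z i)) := by
  have hM' : (0 : ℝ) < M := by exact_mod_cast hM0
  have hN : 0 < M / 2 := by obtain ⟨N, rfl⟩ := hM; omega
  have hcast : ((M / 2 : ℕ) : ℝ) = M / 2 := by
    rw [Nat.cast_div hM.two_dvd two_ne_zero, Nat.cast_ofNat]
  have key : (2 / M : ℝ) * ∑ i, (m - max a (min U (m - secondHalf Z i))) ≤ trimmedMean ε Z := by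
    unfold trimmedMean
    refine mul_le_mul_of_nonneg_left (Finset.sum_le_sum fun i _ => ?_) (by positivity)
    rw [truncate_eq (firstHalf_quantile_le hN hε hε2 _)]
    have hgb := firstHalf_quantile_le hN hε hε2 Z
    generalize quantile ε (firstHalf Z) = γ at *
    generalize quantile (1 - ε) (firstHalf Z) = β at *
    rcases max_cases a (min U (m - secondHalf Z i)) with h₁ | h₁ <;>
    rcases min_cases U (m - secondHalf Z i) with h₂ | h₂ <;>
    rcases max_cases γ (min β (secondHalf Z i)) with h₃ | h₃ <;>
    rcases min_cases β (secondHalf Z i) with h₄ | h₄ <;> linarith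
  rw [Finset.sum_sub_distrib, sum_secondHalf hM (fun x => max a (min U (m - x)))] at key
  simp only [Finset.sum_const, Finset.card_univ, Fintype.card_fin, nsmul_eq_mul, hcast] at key
  have : (2 / M : ℝ) * (M / 2 * m) = m := by field_simp
  linarith

lemma card_firstHalf_le_add_lt {M : ℕ} (Y : Fin M → ℝ) (U : ℝ) :
    (Finset.univ.filter fun i => firstHalf Y i ≤ U).card +
      (Finset.univ.filter fun i : Fin M => i.val < M / 2 ∧ U < Y i).card = M / 2 := by
  have h := Finset.card_filter_add_card_filter_not (s := Finset.univ)
    (fun i => firstHalf Y i ≤ U)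
  simp only [Finset.card_univ, Fintype.card_fin, not_le] at h
  rw [← card_firstHalf (fun x => U < x)]
  exact h

/-- If fewer than `εN` of the `N` entries of the first half exceed `m + U`, and more than `εN` of
them are at most `m + a`, then the truncation levels are at most `m + a` and `m + U`. -/
lemma quantile_firstHalf_le {M : ℕ} (hN : 0 < M / 2) {ε : ℝ} (hε : 0 < ε) (hε2 : ε ≤ 1 / 2)
    (Z : Fin M → ℝ) {m a U : ℝ}
    (hU : ((Finset.univ.filter fun i : Fin M => i.val < M / 2 ∧ U < Z i - m).card : ℝ) <
      ε * (M / 2 : ℕ))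
    (ha : ε * (M / 2 : ℕ) <
      ((Finset.univ.filter fun i : Fin M => i.val < M / 2 ∧ Z i - m ≤ a).card : ℝ)) :
    quantile ε (firstHalf Z) ≤ m + a ∧ quantile (1 - ε) (firstHalf Z) ≤ m + U := by
  constructor
  · refine quantile_le _ hN hε (by linarith) ?_
    rw [card_firstHalf (fun x => x ≤ m + a)]
    simp only [sub_le_iff_le_add'] at ha
    exact ha.le
  · refine quantile_le _ hN (by linarith) (by linarith) ?_
    have h := card_firstHalf_le_add_lt Z (m + U)
    simp only [lt_sub_iff_add_lt'] at hU
    have h' : ((Finset.univ.filter fun i => firstHalf Z i ≤ m + U).card : ℝ) +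
      ((Finset.univ.filter fun i : Fin M => i.val < M / 2 ∧ m + U < Z i).card : ℝ) =
        (M / 2 : ℕ) := by exact_mod_cast h
    linarith

lemma le_quantile_firstHalf {M : ℕ} (hN : 0 < M / 2) {ε : ℝ} (hε : 0 < ε) (hε2 : ε ≤ 1 / 2)
    (Z : Fin M → ℝ) {m a U : ℝ}
    (hU : ((Finset.univ.filter fun i : Fin M => i.val < M / 2 ∧ U < m - Z i).card : ℝ) <
      ε * (M / 2 : ℕ))
    (ha : ε * (M / 2 : ℕ) <
      ((Finset.univ.filter fun i : Fin M => i.val < M / 2 ∧ m - Z i ≤ a).card : ℝ)) :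
    m - U ≤ quantile ε (firstHalf Z) ∧ m - a ≤ quantile (1 - ε) (firstHalf Z) := by
  constructor
  · refine le_quantile _ hN hε (by linarith) ?_
    have h := card_firstHalf_le_add_lt (fun i => m - Z i) U
    have hset : (Finset.univ.filter fun i => m - U ≤ firstHalf Z i) =
        Finset.univ.filter fun i => firstHalf (fun i => m - Z i) i ≤ U :=
      Finset.filter_congr fun i _ => sub_le_comm
    have h' : ((Finset.univ.filter fun i => firstHalf (fun i => m - Z i) i ≤ U).card : ℝ) +
      ((Finset.univ.filter fun i : Fin M => i.val < M / 2 ∧ U < m - Z i).card : ℝ) =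
        (M / 2 : ℕ) := by exact_mod_cast h
    rw [hset]
    linarith
  · refine le_quantile _ hN (by linarith) (by linarith) ?_
    rw [card_firstHalf (fun x => m - a ≤ x)]
    simp only [sub_le_comm (a := m)] at ha
    linarith

/-! ### Concentration for the normal agents -/

section Concentration

variable {M : ℕ} {Ω' : Type*} [MeasurableSpace Ω'] {P : Measure Ω'} [IsProbabilityMeasure P]
  {B : Finset (Fin M)} {X : Fin M → Ω' → ℝ} {ν : Measure ℝ} [IsProbabilityMeasure ν]

/-- A Bernstein-type bound from `exp w ≤ 1 + w + w²` for `|w| ≤ 1`, for a bounded function `w` of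
the independent observations of the normal agents in `S`. -/
lemma measure_le_sum_le_exp (hmeas : ∀ i ∉ B, Measurable (X i))
    (hind : iIndepFun (fun i : {i : Fin M // i ∉ B} => X i) P)
    (hlaw : ∀ i ∉ B, P.map (X i) = ν) {w : ℝ → ℝ} (hw : Measurable w) (hw1 : ∀ x, |w x| ≤ 1)
    {v : ℝ} (hv : ∫ x, w x ∂ν + ∫ x, w x ^ 2 ∂ν ≤ v) (S : Finset (Fin M))
    (hS : ∀ i ∈ S, i ∉ B) (A : ℝ) :
    P {ω | A ≤ ∑ i ∈ S, w (X i ω)} ≤ ENNReal.ofReal (Real.exp (-A + S.card * v)) := by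
  classical
  have hintw : Integrable w ν :=
    Integrable.of_bound hw.aestronglyMeasurable 1 (ae_of_all _ fun x => by simpa using hw1 x)
  have hintw2 : Integrable (fun x => w x ^ 2) ν :=
    Integrable.of_bound (hw.pow_const 2).aestronglyMeasurable 1
      (ae_of_all _ fun x => by
        rw [Real.norm_eq_abs, abs_pow]; exact pow_le_one₀ (abs_nonneg _) (hw1 x))
  have hexpw : ∫ x, Real.exp (w x) ∂ν ≤ Real.exp v := by
    have h1 : ∫ x, Real.exp (w x) ∂ν ≤ ∫ x, ((1 + w x) + w x ^ 2) ∂ν := by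
      refine integral_mono ?_ (((integrable_const _).add hintw).add hintw2) fun x => ?_
      · refine Integrable.of_bound hw.exp.aestronglyMeasurable (Real.exp 1)
          (ae_of_all _ fun x => ?_)
        rw [Real.norm_eq_abs, Real.abs_exp]
        exact Real.exp_le_exp.2 (le_of_abs_le (hw1 x))
      · have := (abs_le.1 (Real.abs_exp_sub_one_sub_id_le (hw1 x))).2
        simp only
        linarith
    have h1w : Integrable (fun x => 1 + w x) ν := (integrable_const _).add hintw
    rw [integral_add h1w hintw2, integral_add (integrable_const _) hintw] at h1
    simp only [integral_const, probReal_univ, smul_eq_mul, mul_one] at h1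
    have := Real.add_one_le_exp v
    linarith
  set W : {i : Fin M // i ∉ B} → Ω' → ℝ := fun i ω => w (X i ω) with hW
  have hWm : ∀ i, Measurable (W i) := fun i => hw.comp (hmeas i i.2)
  have hWind : iIndepFun W P := hind.comp (fun _ => w) (fun _ => hw)
  have hsum : ∀ ω, ∑ i ∈ S, w (X i ω) = (∑ i ∈ S.subtype (· ∉ B), W i) ω := fun ω => by
    rw [Finset.sum_apply]
    exact (Finset.sum_subtype_of_mem (fun i => w (X i ω)) hS).symm
  have hcard : (S.subtype (· ∉ B)).card = S.card := by
    rw [Finset.card_subtype, Finset.filter_true_of_mem hS]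
  have hmgf : mgf (∑ i ∈ S.subtype (· ∉ B), W i) P 1 ≤ Real.exp (S.card * v) := by
    rw [hWind.mgf_sum hWm, Real.exp_nat_mul, ← hcard]
    refine (Finset.prod_le_prod (fun i _ => mgf_nonneg) fun i _ => ?_).trans_eq
      (Finset.prod_const _)
    have : mgf (W i) P 1 = ∫ x, Real.exp (w x) ∂ν := by
      rw [mgf, ← hlaw i i.2, integral_map (hmeas i i.2).aemeasurable
        hw.exp.aestronglyMeasurable]
      simp [hW]
    rw [this]
    exact hexpw
  have hint : Integrable (fun ω => Real.exp (1 * (∑ i ∈ S.subtype (· ∉ B), W i) ω)) P := by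
    refine Integrable.of_bound (Measurable.aestronglyMeasurable ?_) (Real.exp S.card)
      (ae_of_all _ fun ω => ?_)
    · simp only [← hsum]
      exact ((Finset.measurable_sum _ fun i hi => hw.comp (hmeas i (hS i hi))).const_mul 1).exp
    · rw [Real.norm_eq_abs, Real.abs_exp, one_mul, ← hsum]
      refine Real.exp_le_exp.2 ((Finset.sum_le_sum fun i _ => le_of_abs_le (hw1 _)).trans ?_)
      simp
  have hfin := measure_ge_le_exp_mul_mgf (μ := P) A zero_le_one hint
  simp only [← hsum] at hfin
  rw [← ofReal_measureReal]
  refine ENNReal.ofReal_le_ofReal (hfin.trans ?_)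
  rw [Real.exp_add, neg_one_mul]
  gcongr

end Concentration

/-! ### One-sided truncation of a centred law -/

section Law

variable {ν : Measure ℝ} [IsProbabilityMeasure ν] {s r : ℝ}

lemma measureReal_Ioi_le (h2 : MemLp id 2 ν) (hvar : ∫ x, x ^ 2 ∂ν ≤ s ^ 2) {U : ℝ} (hU : 0 < U) :
    ν.real (Set.Ioi U) ≤ s ^ 2 / U ^ 2 := by
  rw [← integral_indicator_one measurableSet_Ioi]
  calc ∫ x, (Set.Ioi U).indicator 1 x ∂ν ≤ ∫ x, x ^ 2 / U ^ 2 ∂ν := by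
        refine integral_mono ((integrable_const (1 : ℝ)).indicator measurableSet_Ioi)
          (h2.integrable_sq.div_const _) fun x => ?_
        by_cases hx : x ∈ Set.Ioi U
        · have hx' : U < x := hx
          simp only [Set.indicator_of_mem hx, Pi.one_apply]
          rw [le_div_iff₀ (by positivity)]
          nlinarith
        · simp only [Set.indicator_of_notMem hx]
          positivity
    _ ≤ s ^ 2 / U ^ 2 := by
        rw [integral_div]
        gcongr

/-- A truncation level `a` at which lower truncation of a centred law moves the mean by exactly
`4 s r`. The expected excess `∫ max 0 (a - x)` is continuous in `a`, so the intermediate value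
theorem applies between a level where Chebyshev's inequality bounds it from above and one where
Jensen's inequality bounds it from below. -/
lemma exists_integral_max_sub_eq (hs : 0 < s) (hr : 0 < r) (h2 : MemLp id 2 ν)
    (h0 : ∫ x, x ∂ν = 0) (hvar : ∫ x, x ^ 2 ∂ν ≤ s ^ 2) :
    ∃ a, -(s / (4 * r)) ≤ a ∧ a ≤ 4 * s * r ∧ ∫ x, max 0 (a - x) ∂ν = 4 * s * r := by
  have h1 : Integrable (fun x : ℝ => x) ν := h2.integrable (by norm_num)
  have hint : ∀ a : ℝ, Integrable (fun x => max 0 (a - x)) ν := fun a =>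
    (integrable_zero _ _ _).sup ((integrable_const a).sub h1)
  have hcont : Continuous fun a : ℝ => ∫ x, max 0 (a - x) ∂ν := by
    refine LipschitzWith.continuous (K := 1) (LipschitzWith.of_dist_le_mul fun a b => ?_)
    rw [Real.dist_eq, Real.dist_eq, ← integral_sub (hint a) (hint b), NNReal.coe_one, one_mul,
      ← Real.norm_eq_abs]
    refine (norm_integral_le_of_norm_le_const (C := |a - b|) (ae_of_all _ fun x => ?_)).trans
      (by simp)
    have := abs_max_sub_max_le_max 0 (a - x) 0 (b - x)
    rw [Real.norm_eq_abs]
    simpa using this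
  have hle : -(s / (4 * r)) ≤ 4 * s * r := by
    have : 0 ≤ s / (4 * r) := by positivity
    have : 0 ≤ 4 * s * r := by positivity
    linarith
  suffices hmem : 4 * s * r ∈ Set.Icc (∫ x, max 0 (-(s / (4 * r)) - x) ∂ν)
      (∫ x, max 0 (4 * s * r - x) ∂ν) by
    obtain ⟨a, ha, h⟩ := intermediate_value_Icc hle hcont.continuousOn hmem
    exact ⟨a, ha.1, ha.2, h⟩
  constructor
  · calc ∫ x, max 0 (-(s / (4 * r)) - x) ∂ν ≤ ∫ x, x ^ 2 * (r / s) ∂ν := by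
          refine integral_mono (hint _) (h2.integrable_sq.mul_const _) fun x => ?_
          refine max_le (by positivity) ?_
          -- `-c - x ≤ x² / (4 c)` for `c = s / (4 r)`
          have e : x ^ 2 * (r / s) - (-(s / (4 * r)) - x) =
              (r / s) * (x + s / (2 * r)) ^ 2 := by
            field_simp
            ring
          have : 0 ≤ (r / s) * (x + s / (2 * r)) ^ 2 := by positivity
          linarith
      _ ≤ s ^ 2 * (r / s) := by
          rw [integral_mul_const]
          gcongr
      _ ≤ 4 * s * r := by
          have : s ^ 2 * (r / s) = s * r := by field_simp
          rw [this]
          nlinarith [mul_pos hs hr]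
  · calc 4 * s * r = ∫ x, (4 * s * r - x) ∂ν := by
          rw [integral_sub (integrable_const _) h1, h0]
          simp
      _ ≤ _ := integral_mono ((integrable_const _).sub h1) (hint _) fun x => le_max_right _ _

/-- By the Cauchy-Schwarz inequality, the level `a` of `exists_integral_max_sub_eq` has a
considerable mass below it. -/
lemma le_measureReal_Iic (hs : 0 < s) (hr : 0 < r) (hr4 : r ≤ 1 / 4) (h2 : MemLp id 2 ν)
    (h0 : ∫ x, x ∂ν = 0) (hvar : ∫ x, x ^ 2 ∂ν ≤ s ^ 2) {a : ℝ} (ha : a ≤ 4 * s * r)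
    (h : ∫ x, max 0 (a - x) ∂ν = 4 * s * r) : 8 * r ^ 2 ≤ ν.real (Set.Iic a) := by
  have h1 : Integrable (fun x : ℝ => x) ν := h2.integrable (by norm_num)
  have hsq : Integrable (fun x : ℝ => x ^ 2) ν := h2.integrable_sq
  have hint : Integrable (fun x => max 0 (a - x)) ν :=
    (integrable_zero _ _ _).sup ((integrable_const a).sub h1)
  have hind : Integrable ((Set.Iic a).indicator (1 : ℝ → ℝ)) ν :=
    (integrable_const (1 : ℝ)).indicator measurableSet_Iic
  set t := s / (2 * r) with ht
  have htp : 0 < t := by positivity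
  set A := max 0 a with hA
  have hA0 : 0 ≤ A := le_max_left _ _
  have hAs : A ≤ s := max_le hs.le (ha.trans (by nlinarith))
  -- Young's inequality with weight `t`, the ratio of `2 s²` to `4 s r`
  have hpt : ∀ x, max 0 (a - x) ≤
      t / 2 * (Set.Iic a).indicator 1 x + (A ^ 2 - 2 * A * x + x ^ 2) / (2 * t) := by
    intro x
    by_cases hx : x ∈ Set.Iic a
    · have hx' : x ≤ a := hx
      rw [Set.indicator_of_mem hx, Pi.one_apply, max_eq_right (by linarith), mul_one]
      have e : t / 2 + (A ^ 2 - 2 * A * x + x ^ 2) / (2 * t) - (A - x) =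
          (A - x - t) ^ 2 / (2 * t) := by
        field_simp
        ring
      have : 0 ≤ (A - x - t) ^ 2 / (2 * t) := by positivity
      have : a ≤ A := le_max_right _ _
      linarith
    · have hx' : a < x := by simpa using hx
      rw [Set.indicator_of_notMem hx, max_eq_left (by linarith)]
      have : 0 ≤ (A ^ 2 - 2 * A * x + x ^ 2) / (2 * t) := by
        have : A ^ 2 - 2 * A * x + x ^ 2 = (A - x) ^ 2 := by ring
        rw [this]
        positivity
      linarith
  have hI1 : Integrable (fun x => A ^ 2 - 2 * A * x) ν :=
    (integrable_const _).sub (h1.const_mul _)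
  have hI2 : Integrable (fun x => (A ^ 2 - 2 * A * x + x ^ 2) / (2 * t)) ν :=
    (hI1.add hsq).div_const (2 * t)
  have hle := integral_mono hint ((hind.const_mul (t / 2)).add hI2) hpt
  simp only [Pi.add_apply] at hle
  rw [h, integral_add (hind.const_mul _) hI2, integral_const_mul,
    integral_indicator_one measurableSet_Iic, integral_div, integral_add hI1 hsq,
    integral_sub (integrable_const _) (h1.const_mul _), integral_const_mul, h0] at hle
  simp only [integral_const, probReal_univ, smul_eq_mul, one_mul, mul_zero, sub_zero] at hle
  have hV : (A ^ 2 + ∫ x, x ^ 2 ∂ν) / (2 * t) ≤ 2 * s ^ 2 / (2 * t) := by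
    gcongr
    nlinarith
  have e : 2 * s ^ 2 / (2 * t) = 2 * s * r := by rw [ht]; field_simp
  rw [e] at hV
  have h3 : 2 * s * r ≤ s / (2 * r) / 2 * ν.real (Set.Iic a) := by linarith
  have e2 : s / (2 * r) / 2 * ν.real (Set.Iic a) = s * ν.real (Set.Iic a) / (4 * r) := by
    field_simp
    ring
  rw [e2, le_div_iff₀ (by positivity)] at h3
  have : s * (8 * r ^ 2) ≤ s * ν.real (Set.Iic a) := by linarith
  exact le_of_mul_le_mul_left this hs

/-- Mean and second moment of the two-sided truncation of a centred law. -/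
lemma integral_truncation_le (hs : 0 < s) (hr : 0 < r) (hr4 : r ≤ 1 / 4) (h2 : MemLp id 2 ν)
    (h0 : ∫ x, x ∂ν = 0) (hvar : ∫ x, x ^ 2 ∂ν ≤ s ^ 2) {a U : ℝ} (ha : a ≤ 4 * s * r)
    (h : ∫ x, max 0 (a - x) ∂ν = 4 * s * r) (hU : 0 < U) (haU : -U ≤ a) (haU' : a ≤ U) :
    ∫ x, max a (min U x) ∂ν ≤ 4 * s * r ∧ ∫ x, max a (min U x) ^ 2 ∂ν ≤ 2 * s ^ 2 := by
  have h1 : Integrable (fun x : ℝ => x) ν := h2.integrable (by norm_num)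
  have hsq : Integrable (fun x : ℝ => x ^ 2) ν := h2.integrable_sq
  have hint : Integrable (fun x => max 0 (a - x)) ν :=
    (integrable_zero _ _ _).sup ((integrable_const a).sub h1)
  have hbd : ∀ x, |max a (min U x)| ≤ U := fun x =>
    abs_le.2 ⟨haU.trans (le_max_left _ _), max_le haU' (min_le_left _ _)⟩
  have hm : Measurable fun x : ℝ => max a (min U x) := by fun_prop
  constructor
  · calc ∫ x, max a (min U x) ∂ν ≤ ∫ x, (x + max 0 (a - x)) ∂ν := by
          refine integral_mono (Integrable.of_bound hm.aestronglyMeasurable U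
            (ae_of_all _ fun x => by simpa using hbd x)) (h1.add hint) fun x => ?_
          refine max_le ?_ ?_
          · have := le_max_right 0 (a - x)
            linarith
          · have h₁ := le_max_left 0 (a - x)
            have h₂ := min_le_right U x
            simp only
            linarith
      _ = 4 * s * r := by rw [integral_add h1 hint, h0, h, zero_add]
  · calc ∫ x, max a (min U x) ^ 2 ∂ν ≤ ∫ x, (s ^ 2 + x ^ 2) ∂ν := by
          refine integral_mono (Integrable.of_bound (hm.pow_const 2).aestronglyMeasurable (U ^ 2)
            (ae_of_all _ fun x => ?_)) ((integrable_const _).add hsq) fun x => ?_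
          · rw [Real.norm_eq_abs, abs_pow]
            exact pow_le_pow_left₀ (abs_nonneg _) (hbd x) 2
          · have has : a ≤ s := ha.trans (by nlinarith)
            simp only
            rcases max_cases a (min U x) with h₁ | h₁ <;> rcases min_cases U x with h₂ | h₂ <;>
              rw [h₁.1] <;> rcases le_total 0 a with h₃ | h₃ <;> nlinarith
      _ ≤ 2 * s ^ 2 := by
          rw [integral_add (integrable_const _) hsq]
          simp only [integral_const, probReal_univ, smul_eq_mul, one_mul]
          linarith

end Law

/-! ### Deviation of the trimmed mean under corruption -/

/-- The normal agents in the first half of the sample. -/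
def honestFirst {M : ℕ} (B : Finset (Fin M)) : Finset (Fin M) :=
  Finset.univ.filter fun i => i ∉ B ∧ i.val < M / 2

/-- The normal agents in the second half of the sample. -/
def honestSecond {M : ℕ} (B : Finset (Fin M)) : Finset (Fin M) :=
  Finset.univ.filter fun i => i ∉ B ∧ M / 2 ≤ i.val

section Deterministic

variable {M : ℕ} {B : Finset (Fin M)} {Y X : Fin M → ℝ}

lemma card_filter_le_add_card (hY : ∀ i ∉ B, Y i = X i) (p : ℝ → Prop) [DecidablePred p] :
    (Finset.univ.filter fun i : Fin M => i.val < M / 2 ∧ p (Y i)).card ≤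
      ((honestFirst B).filter fun i => p (X i)).card + B.card := by
  refine (Finset.card_le_card fun i hi => ?_).trans (Finset.card_union_le _ _)
  simp only [Finset.mem_filter, Finset.mem_univ, true_and] at hi
  simp only [Finset.mem_union, Finset.mem_filter, Finset.mem_univ, true_and, honestFirst]
  by_cases h : i ∈ B
  · exact Or.inr h
  · exact Or.inl ⟨⟨h, hi.1⟩, hY i h ▸ hi.2⟩

lemma card_honestFirst_filter_le (hY : ∀ i ∉ B, Y i = X i) (p : ℝ → Prop) [DecidablePred p] :
    ((honestFirst B).filter fun i => p (X i)).card ≤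
      (Finset.univ.filter fun i : Fin M => i.val < M / 2 ∧ p (Y i)).card := by
  refine Finset.card_le_card fun i hi => ?_
  simp only [Finset.mem_filter, Finset.mem_univ, true_and, honestFirst] at hi ⊢
  exact ⟨hi.1.2, (hY i hi.1.1).symm ▸ hi.2⟩

lemma sum_le_sum_honestSecond (hY : ∀ i ∉ B, Y i = X i) {F : ℝ → ℝ} {U : ℝ} (hU : 0 ≤ U)
    (hF : ∀ x, F x ≤ U) :
    ∑ i : Fin M with M / 2 ≤ i.val, F (Y i) ≤ ∑ i ∈ honestSecond B, F (X i) + B.card * U := by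
  rw [← Finset.sum_filter_add_sum_filter_not _ (· ∉ B)]
  refine add_le_add (le_of_eq ?_) ?_
  · rw [Finset.filter_filter]
    refine Finset.sum_congr ?_ fun i hi => ?_
    · ext i
      simp [honestSecond, and_comm]
    · simp only [honestSecond, Finset.mem_filter, Finset.mem_univ, true_and] at hi
      rw [hY i hi.1]
  · refine (Finset.sum_le_card_nsmul _ _ U fun i _ => hF _).trans ?_
    rw [nsmul_eq_mul]
    refine mul_le_mul_of_nonneg_right (Nat.cast_le.2 (Finset.card_le_card fun i hi => ?_)) hU
    simp only [Finset.mem_filter, not_not] at hi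
    exact hi.2

variable {ε m a U : ℝ} {Z : Fin M → ℝ}

/-- What the normal agents' centred data must satisfy for the truncation levels and the average of
the second half to be under control on one side, whatever the Byzantine agents send. -/
structure IsControlled (B : Finset (Fin M)) (ε a U : ℝ) (X : Fin M → ℝ) : Prop where
  few_above : (((honestFirst B).filter fun i => U < X i).card : ℝ) < ε * (M / 2 : ℕ) / 2
  many_below : ε * (M / 2 : ℕ) < (((honestFirst B).filter fun i => X i ≤ a).card : ℝ)
  sum_lt : ∑ i ∈ honestSecond B, max a (min U (X i)) < 3 * (ε * (M / 2 : ℕ)) * U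

lemma cast_half (hM : Even M) : ((M / 2 : ℕ) : ℝ) = M / 2 := by
  rw [Nat.cast_div hM.two_dvd two_ne_zero, Nat.cast_ofNat]

lemma card_above_lt (hB : (B.card : ℝ) ≤ ε * (M / 2 : ℕ) / 4) (hε : 0 < ε) (hN : 0 < M / 2)
    (hY : ∀ i ∉ B, Y i = X i)
    (h : (((honestFirst B).filter fun i => U < X i).card : ℝ) < ε * (M / 2 : ℕ) / 2) :
    ((Finset.univ.filter fun i : Fin M => i.val < M / 2 ∧ U < Y i).card : ℝ) <
      ε * (M / 2 : ℕ) := by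
  have h₁ := card_filter_le_add_card hY (fun x => U < x)
  have h₂ : ((Finset.univ.filter fun i : Fin M => i.val < M / 2 ∧ U < Y i).card : ℝ) ≤
      ((honestFirst B).filter fun i => U < X i).card + B.card := by exact_mod_cast h₁
  have : 0 < ε * (M / 2 : ℕ) := mul_pos hε (by exact_mod_cast hN)
  linarith

lemma IsControlled.mean_le (hM : Even M) (hM0 : 0 < M) (hU : 0 ≤ U) (haU : a ≤ U)
    (hB : (B.card : ℝ) ≤ ε * (M / 2 : ℕ) / 4) (h : IsControlled B ε a U X)
    (hY : ∀ i ∉ B, Y i = X i) :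
    (2 / M : ℝ) * ∑ i : Fin M with M / 2 ≤ i.val, max a (min U (Y i)) ≤ 4 * ε * U := by
  have hM' : (0 : ℝ) < M := by exact_mod_cast hM0
  have h₁ := sum_le_sum_honestSecond hY hU
    (F := fun x => max a (min U x)) (fun x => max_le haU (min_le_left _ _))
  have h₂ := h.sum_lt
  have h₃ : (B.card : ℝ) * U ≤ ε * (M / 2 : ℕ) / 4 * U := by gcongr
  have h₄ : 0 ≤ ε * (M / 2 : ℕ) * U := by
    have : (0 : ℝ) ≤ B.card := by positivity
    exact mul_nonneg (by linarith) hU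
  have h₅ : ∑ i : Fin M with M / 2 ≤ i.val, max a (min U (Y i)) ≤ 4 * (ε * (M / 2 : ℕ)) * U := by
    linarith
  calc (2 / M : ℝ) * ∑ i : Fin M with M / 2 ≤ i.val, max a (min U (Y i))
      ≤ (2 / M : ℝ) * (4 * (ε * (M / 2 : ℕ)) * U) := by gcongr
    _ = 4 * ε * U := by
      rw [cast_half hM]
      field_simp

lemma IsControlled.trimmedMean_sub_le (hM : Even M) (hM0 : 0 < M) (hε : 0 < ε) (hε2 : ε ≤ 1 / 2)
    (hU : 0 ≤ U) (haU : a ≤ U) (hB : (B.card : ℝ) ≤ ε * (M / 2 : ℕ) / 4)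
    (h : IsControlled B ε a U X) (hZ : ∀ i ∉ B, Z i - m = X i) :
    trimmedMean ε Z - m ≤ 4 * ε * U := by
  have hN : 0 < M / 2 := by obtain ⟨N, rfl⟩ := hM; omega
  obtain ⟨h₁, h₂⟩ := quantile_firstHalf_le hN hε hε2 Z (m := m)
    (card_above_lt hB hε hN hZ h.few_above)
    (h.many_below.trans_le (by exact_mod_cast card_honestFirst_filter_le hZ (fun x => x ≤ a)))
  exact (RDEG.trimmedMean_sub_le hM hM0 hε hε2 Z h₁ h₂).trans
    (h.mean_le hM hM0 hU haU hB hZ)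

lemma IsControlled.sub_trimmedMean_le (hM : Even M) (hM0 : 0 < M) (hε : 0 < ε) (hε2 : ε ≤ 1 / 2)
    (hU : 0 ≤ U) (haU : a ≤ U) (hB : (B.card : ℝ) ≤ ε * (M / 2 : ℕ) / 4)
    (h : IsControlled B ε a U X) (hZ : ∀ i ∉ B, m - Z i = X i) :
    m - trimmedMean ε Z ≤ 4 * ε * U := by
  have hN : 0 < M / 2 := by obtain ⟨N, rfl⟩ := hM; omega
  obtain ⟨h₁, h₂⟩ := le_quantile_firstHalf hN hε hε2 Z (m := m)
    (card_above_lt hB hε hN hZ h.few_above)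
    (h.many_below.trans_le (by exact_mod_cast card_honestFirst_filter_le hZ (fun x => x ≤ a)))
  exact (RDEG.sub_trimmedMean_le hM hM0 hε hε2 Z h₁ h₂).trans
    (h.mean_le hM hM0 hU haU hB hZ)

lemma le_card_honestFirst (hB : (B.card : ℝ) ≤ ε * (M / 2 : ℕ) / 4) :
    ((M / 2 : ℕ) : ℝ) - ε * (M / 2 : ℕ) / 4 ≤ (honestFirst B).card := by
  have h₁ := card_filter_le_add_card (B := B) (Y := fun _ => 0) (X := fun _ => 0)
    (fun _ _ => rfl) (fun _ => True)
  have h₂ := card_firstHalf (fun _ => True) (fun _ : Fin M => 0)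
  simp only [Finset.filter_true, Finset.card_univ, Fintype.card_fin] at h₁ h₂
  rw [← h₂] at h₁
  have h₃ : ((M / 2 : ℕ) : ℝ) ≤ (honestFirst B).card + B.card := by exact_mod_cast h₁
  linarith

lemma card_honestFirst_le : (honestFirst B).card ≤ M / 2 := by
  have h₁ := card_honestFirst_filter_le (B := B) (Y := fun _ => 0) (X := fun _ => 0)
    (fun _ _ => rfl) (fun _ => True)
  rw [← card_firstHalf (fun _ => True) (fun _ : Fin M => 0)] at h₁
  simpa using h₁

lemma card_honestSecond_le (hM : Even M) : (honestSecond B).card ≤ M / 2 := by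
  have h := sum_secondHalf hM (fun _ => 1) (fun _ => 0)
  simp only [Finset.sum_const, Finset.card_univ, Fintype.card_fin, nsmul_eq_mul, mul_one] at h
  have h' : M / 2 = (Finset.univ.filter fun i : Fin M => M / 2 ≤ i.val).card := by exact_mod_cast h
  rw [h']
  refine Finset.card_le_card fun i hi => ?_
  simp only [honestSecond, Finset.mem_filter, Finset.mem_univ, true_and] at hi ⊢
  exact hi.2

/-- Few normal observations above `U` already bound the one-sided error by `U`: this is
`IsControlled.trimmedMean_sub_le` with `a = U`, where the truncation at `[U, U]` is constant. -/
lemma trimmedMean_sub_le_of_few_above (hM : Even M) (hM0 : 0 < M) (hε : 0 < ε) (hε2 : ε ≤ 1 / 2)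
    (hB : (B.card : ℝ) ≤ ε * (M / 2 : ℕ) / 4)
    (h : (((honestFirst B).filter fun i => U < X i).card : ℝ) < ε * (M / 2 : ℕ) / 2) :
    ((∀ i ∉ B, Z i - m = X i) → trimmedMean ε Z - m ≤ U) ∧
      ((∀ i ∉ B, m - Z i = X i) → m - trimmedMean ε Z ≤ U) := by
  have hM' : (0 : ℝ) < M := by exact_mod_cast hM0
  have hN : 0 < M / 2 := by obtain ⟨N, rfl⟩ := hM; omega
  have hN' : (0 : ℝ) < (M / 2 : ℕ) := by exact_mod_cast hN
  have hbelow : ε * (M / 2 : ℕ) < (((honestFirst B).filter fun i => X i ≤ U).card : ℝ) := by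
    have h₁ := Finset.card_filter_add_card_filter_not (s := honestFirst B) (fun i => X i ≤ U)
    simp only [not_le] at h₁
    have h₂ : (((honestFirst B).filter fun i => X i ≤ U).card : ℝ) +
      ((honestFirst B).filter fun i => U < X i).card = (honestFirst B).card := by
      exact_mod_cast h₁
    have h₃ := le_card_honestFirst hB
    nlinarith
  have hmean : ∀ Y : Fin M → ℝ,
      (2 / M : ℝ) * ∑ i : Fin M with M / 2 ≤ i.val, max U (min U (Y i)) = U := fun Y => by
    have hsum := sum_secondHalf hM (fun x => max U (min U x)) Y
    rw [← hsum]
    simp only [max_eq_left (min_le_left U _), Finset.sum_const, Finset.card_univ,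
      Fintype.card_fin, nsmul_eq_mul, cast_half hM]
    field_simp
  constructor <;> intro hZ
  · obtain ⟨h₁, h₂⟩ := quantile_firstHalf_le hN hε hε2 Z (m := m) (card_above_lt hB hε hN hZ h)
      (hbelow.trans_le (by exact_mod_cast card_honestFirst_filter_le hZ (fun x => x ≤ U)))
    exact (trimmedMean_sub_le hM hM0 hε hε2 Z h₁ h₂).trans_eq (hmean _)
  · obtain ⟨h₁, h₂⟩ := le_quantile_firstHalf hN hε hε2 Z (m := m) (card_above_lt hB hε hN hZ h)
      (hbelow.trans_le (by exact_mod_cast card_honestFirst_filter_le hZ (fun x => x ≤ U)))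
    exact (sub_trimmedMean_le hM hM0 hε hε2 Z h₁ h₂).trans_eq (hmean _)

end Deterministic

section Probability

variable {M : ℕ} {Ω' : Type*} [MeasurableSpace Ω'] {P : Measure Ω'} [IsProbabilityMeasure P]
  {B : Finset (Fin M)} {X : Fin M → Ω' → ℝ} {ν : Measure ℝ} [IsProbabilityMeasure ν]
  {s ε : ℝ}

lemma measure_not_few_above_le (hmeas : ∀ i ∉ B, Measurable (X i))
    (hind : iIndepFun (fun i : {i : Fin M // i ∉ B} => X i) P)
    (hlaw : ∀ i ∉ B, P.map (X i) = ν) (hs : 0 < s) (hε : 0 < ε) (h2 : MemLp id 2 ν)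
    (hvar : ∫ x, x ^ 2 ∂ν ≤ s ^ 2) :
    P {ω | ¬ (((honestFirst B).filter fun i => 4 * s / √ε < X i ω).card : ℝ) <
        ε * (M / 2 : ℕ) / 2} ≤
      ENNReal.ofReal (Real.exp (-(3 / 8 * (ε * (M / 2 : ℕ))))) := by
  have hr : 0 < √ε := Real.sqrt_pos.2 hε
  have hU : 0 < 4 * s / √ε := by positivity
  have hp := measureReal_Ioi_le h2 hvar hU
  have e : s ^ 2 / (4 * s / √ε) ^ 2 = ε / 16 := by
    rw [div_pow, mul_pow, Real.sq_sqrt hε.le]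
    field_simp
    norm_num
  rw [e] at hp
  set U := 4 * s / √ε
  have hv : ∫ x, (Set.Ioi U).indicator 1 x ∂ν + ∫ x, ((Set.Ioi U).indicator 1 x) ^ 2 ∂ν ≤
      ε / 8 := by
    have : ∀ x : ℝ, ((Set.Ioi U).indicator (1 : ℝ → ℝ) x) ^ 2 = (Set.Ioi U).indicator 1 x :=
      fun x => by by_cases hx : x ∈ Set.Ioi U <;> simp [hx]
    simp only [this]
    rw [integral_indicator_one measurableSet_Ioi]
    linarith
  have hch := measure_le_sum_le_exp hmeas hind hlaw
    (w := (Set.Ioi U).indicator 1) (measurable_one.indicator measurableSet_Ioi)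
    (fun x => by by_cases hx : x ∈ Set.Ioi U <;> simp [hx]) hv (honestFirst B)
    (fun i hi => (Finset.mem_filter.1 hi).2.1) (ε * (M / 2 : ℕ) / 2)
  refine (measure_mono fun ω hω => ?_).trans (hch.trans (ENNReal.ofReal_le_ofReal
    (Real.exp_le_exp.2 ?_)))
  · have : ∑ i ∈ honestFirst B, (Set.Ioi U).indicator (1 : ℝ → ℝ) (X i ω) =
        ((honestFirst B).filter fun i => U < X i ω).card := by
      simp only [Set.indicator_apply, Set.mem_Ioi, Pi.one_apply, Finset.sum_boole]
    rw [Set.mem_ofPred_eq, this]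
    exact not_lt.1 hω
  · have : ((honestFirst B).card : ℝ) ≤ (M / 2 : ℕ) := by exact_mod_cast card_honestFirst_le
    nlinarith

/-- For normal data with a centred law, the one-sided control fails with exponentially small
probability. -/
lemma exists_measure_not_isControlled_le (hM : Even M) (hmeas : ∀ i ∉ B, Measurable (X i))
    (hind : iIndepFun (fun i : {i : Fin M // i ∉ B} => X i) P)
    (hlaw : ∀ i ∉ B, P.map (X i) = ν) (hs : 0 < s) (hε : 0 < ε) (hε16 : ε ≤ 1 / 16)
    (hB : (B.card : ℝ) ≤ ε * (M / 2 : ℕ) / 4) (h2 : MemLp id 2 ν)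
    (h0 : ∫ x, x ∂ν = 0) (hvar : ∫ x, x ^ 2 ∂ν ≤ s ^ 2) :
    ∃ a ≤ 4 * s / √ε, P {ω | ¬ IsControlled B ε a (4 * s / √ε) fun i => X i ω} ≤
      ENNReal.ofReal (3 * Real.exp (-(3 / 8 * (ε * (M / 2 : ℕ))))) := by
  have hr : 0 < √ε := Real.sqrt_pos.2 hε
  have hr2 : √ε ^ 2 = ε := Real.sq_sqrt hε.le
  have hr4 : √ε ≤ 1 / 4 := by
    rw [show (1 / 4 : ℝ) = √(1 / 16) by
      rw [show (1 / 16 : ℝ) = (1 / 4) ^ 2 by norm_num, Real.sqrt_sq (by norm_num)]]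
    exact Real.sqrt_le_sqrt hε16
  have hfew := measure_not_few_above_le hmeas hind hlaw hs hε h2 hvar
  obtain ⟨a, ha₁, ha₂, ha⟩ := exists_integral_max_sub_eq hs hr h2 h0 hvar
  have hp := le_measureReal_Iic hs hr hr4 h2 h0 hvar ha₂ ha
  rw [hr2] at hp
  have hK : 0 ≤ ε * (M / 2 : ℕ) := by positivity
  have hUpos : 0 < 4 * s / √ε := by positivity
  have haU : a ≤ 4 * s / √ε := by
    refine ha₂.trans ((le_div_iff₀ hr).2 ?_)
    nlinarith
  have haU' : -(4 * s / √ε) ≤ a := by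
    refine (neg_le_neg ?_).trans ha₁
    rw [div_le_div_iff₀ (by positivity) hr]
    nlinarith [mul_pos hs hr]
  obtain ⟨hm1, hm2⟩ := integral_truncation_le hs hr hr4 h2 h0 hvar ha₂ ha hUpos haU' haU
  have hUr : √ε / (4 * s) * (4 * s / √ε) = 1 := by field_simp
  refine ⟨a, haU, ?_⟩
  set U := 4 * s / √ε with hU
  -- many observations lie below `a`
  have hmany : P {ω | ¬ ε * (M / 2 : ℕ) < (((honestFirst B).filter fun i => X i ω ≤ a).card : ℝ)} ≤
      ENNReal.ofReal (Real.exp (-(3 / 8 * (ε * (M / 2 : ℕ))))) := by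
    set w : ℝ → ℝ := fun x => -(1 / 2) * (Set.Iic a).indicator 1 x with hw
    have hv : ∫ x, w x ∂ν + ∫ x, w x ^ 2 ∂ν ≤ -(2 * ε) := by
      have : ∀ x : ℝ, w x ^ 2 = 1 / 4 * (Set.Iic a).indicator 1 x := fun x => by
        by_cases hx : x ∈ Set.Iic a
        · simp only [hw, Set.indicator_of_mem hx, Pi.one_apply]; norm_num
        · simp [hw, Set.indicator_of_notMem hx]
      simp only [this]
      rw [hw, integral_const_mul, integral_const_mul, integral_indicator_one measurableSet_Iic]
      linarith
    have hch := measure_le_sum_le_exp hmeas hind hlaw (w := w)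
      ((measurable_one.indicator measurableSet_Iic).const_mul _)
      (fun x => by
        by_cases hx : x ∈ Set.Iic a
        · simp only [hw, Set.indicator_of_mem hx, Pi.one_apply]; norm_num
        · simp [hw, Set.indicator_of_notMem hx]) hv (honestFirst B)
      (fun i hi => (Finset.mem_filter.1 hi).2.1) (-(1 / 2) * (ε * (M / 2 : ℕ)))
    refine (measure_mono fun ω hω => ?_).trans (hch.trans (ENNReal.ofReal_le_ofReal
      (Real.exp_le_exp.2 ?_)))
    · have : ∑ i ∈ honestFirst B, w (X i ω) =
          -(1 / 2) * ((honestFirst B).filter fun i => X i ω ≤ a).card := by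
        rw [hw, ← Finset.mul_sum]
        simp only [Set.indicator_apply, Set.mem_Iic, Pi.one_apply, Finset.sum_boole]
      rw [Set.mem_ofPred_eq, this]
      have := not_lt.1 hω
      linarith
    · have h₁ := le_card_honestFirst hB
      have h₂ : 2 * ε * ((M / 2 : ℕ) - ε * (M / 2 : ℕ) / 4) ≤ 2 * ε * (honestFirst B).card := by
        gcongr
      have h₃ : ε * (ε * (M / 2 : ℕ)) ≤ 1 / 16 * (ε * (M / 2 : ℕ)) := by gcongr
      linarith
  -- the truncated mean of the second half
  have hsum : P {ω | ¬ ∑ i ∈ honestSecond B, max a (min U (X i ω)) < 3 * (ε * (M / 2 : ℕ)) * U} ≤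
      ENNReal.ofReal (Real.exp (-(3 / 8 * (ε * (M / 2 : ℕ))))) := by
    set w : ℝ → ℝ := fun x => √ε / (4 * s) * max a (min U x) with hw
    have hv : ∫ x, w x ∂ν + ∫ x, w x ^ 2 ∂ν ≤ 2 * ε := by
      simp only [hw, mul_pow]
      rw [integral_const_mul, integral_const_mul]
      have h₁ : √ε / (4 * s) * ∫ x, max a (min U x) ∂ν ≤ √ε / (4 * s) * (4 * s * √ε) := by
        gcongr
      have h₂ : (√ε / (4 * s)) ^ 2 * ∫ x, max a (min U x) ^ 2 ∂ν ≤
          (√ε / (4 * s)) ^ 2 * (2 * s ^ 2) := by gcongr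
      have e₁ : √ε / (4 * s) * (4 * s * √ε) = √ε ^ 2 := by field_simp
      have e₂ : (√ε / (4 * s)) ^ 2 * (2 * s ^ 2) = √ε ^ 2 / 8 := by field_simp; norm_num
      rw [e₁, hr2] at h₁
      rw [e₂, hr2] at h₂
      linarith
    have hch := measure_le_sum_le_exp hmeas hind hlaw (w := w)
      (by simp only [hw]; fun_prop)
      (fun x => by
        rw [hw, abs_mul, abs_of_pos (by positivity : 0 < √ε / (4 * s)), ← hUr]
        refine mul_le_mul_of_nonneg_left (abs_le.2 ⟨haU'.trans (le_max_left _ _),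
          max_le haU (min_le_left _ _)⟩) (by positivity)) hv (honestSecond B)
      (fun i hi => (Finset.mem_filter.1 hi).2.1) (3 * (ε * (M / 2 : ℕ)))
    refine (measure_mono fun ω hω => ?_).trans (hch.trans (ENNReal.ofReal_le_ofReal
      (Real.exp_le_exp.2 ?_)))
    · have h₁ := not_lt.1 hω
      rw [Set.mem_ofPred_eq, hw, ← Finset.mul_sum]
      calc 3 * (ε * (M / 2 : ℕ)) = √ε / (4 * s) * (3 * (ε * (M / 2 : ℕ)) * U) := by
            rw [mul_left_comm (√ε / (4 * s)), hUr, mul_one]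
        _ ≤ _ := by gcongr
    · have : ((honestSecond B).card : ℝ) ≤ (M / 2 : ℕ) := by
        exact_mod_cast card_honestSecond_le hM
      nlinarith
  calc P {ω | ¬ IsControlled B ε a U fun i => X i ω}
      ≤ P (({ω | ¬ (((honestFirst B).filter fun i => U < X i ω).card : ℝ) <
          ε * (M / 2 : ℕ) / 2} ∪
        {ω | ¬ ε * (M / 2 : ℕ) < (((honestFirst B).filter fun i => X i ω ≤ a).card : ℝ)}) ∪
        {ω | ¬ ∑ i ∈ honestSecond B, max a (min U (X i ω)) < 3 * (ε * (M / 2 : ℕ)) * U}) := by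
        refine measure_mono fun ω hω => ?_
        by_contra hcon
        simp only [Set.mem_union, Set.mem_ofPred_eq, not_or, not_not] at hcon
        exact hω ⟨hcon.1.1, hcon.1.2, hcon.2⟩
    _ ≤ _ := (measure_union_le _ _).trans (add_le_add_left (measure_union_le _ _) _)
    _ ≤ _ := add_le_add (add_le_add hfew hmany) hsum
    _ = _ := by
      rw [← ENNReal.ofReal_add (by positivity) (by positivity),
        ← ENNReal.ofReal_add (by positivity) (by positivity)]
      congr 1
      ring

end Probability

section Probability

variable {M : ℕ} {Ω' : Type*} [MeasurableSpace Ω'] {P : Measure Ω'} [IsProbabilityMeasure P]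
  {B : Finset (Fin M)} {X : Fin M → Ω' → ℝ} {ν : Measure ℝ} [IsProbabilityMeasure ν]
  {s ε m : ℝ}

/-- The error of the trimmed mean on one side is `O(s √ε)`, uniformly over the corruptions. The two
implications treat the two sides: the first one is for the data, the second one for their
negatives. -/
lemma measure_one_sided_le (hM : Even M) (hM0 : 0 < M) (hmeas : ∀ i ∉ B, Measurable (X i))
    (hind : iIndepFun (fun i : {i : Fin M // i ∉ B} => X i) P)
    (hlaw : ∀ i ∉ B, P.map (X i) = ν) (hs : 0 < s) (hε : 0 < ε) (hε2 : ε ≤ 1 / 2)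
    (hB : (B.card : ℝ) ≤ ε * (M / 2 : ℕ) / 4) (h2 : MemLp id 2 ν)
    (h0 : ∫ x, x ∂ν = 0) (hvar : ∫ x, x ^ 2 ∂ν ≤ s ^ 2) :
    P {ω | ¬ ∀ (m : ℝ) (Z : Fin M → ℝ),
        ((∀ i ∉ B, Z i - m = X i ω) → trimmedMean ε Z - m ≤ 64 * s * √ε) ∧
        ((∀ i ∉ B, m - Z i = X i ω) → m - trimmedMean ε Z ≤ 64 * s * √ε)} ≤
      ENNReal.ofReal (3 * Real.exp (-(3 / 8 * (ε * (M / 2 : ℕ))))) := by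
  have hr : 0 < √ε := Real.sqrt_pos.2 hε
  have hr2 : √ε * √ε = ε := Real.mul_self_sqrt hε.le
  have hUpos : 0 ≤ 4 * s / √ε := by positivity
  rcases le_total ε (1 / 16) with hε16 | hε16
  · obtain ⟨a, haU, ha⟩ := exists_measure_not_isControlled_le hM hmeas hind hlaw hs hε hε16 hB
      h2 h0 hvar
    refine (measure_mono fun ω hω => ?_).trans ha
    refine fun hc => hω fun m Z => ?_
    have e : 4 * ε * (4 * s / √ε) ≤ 64 * s * √ε := by
      rw [mul_div_assoc', div_le_iff₀ hr, mul_assoc (64 * s), hr2]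
      nlinarith [mul_pos hs hε]
    exact ⟨fun hZ => (hc.trimmedMean_sub_le hM hM0 hε hε2 hUpos haU hB hZ).trans e,
      fun hZ => (hc.sub_trimmedMean_le hM hM0 hε hε2 hUpos haU hB hZ).trans e⟩
  · have hfew := measure_not_few_above_le hmeas hind hlaw hs hε h2 hvar
    refine (measure_mono fun ω hω => ?_).trans (hfew.trans (ENNReal.ofReal_le_ofReal ?_))
    · refine fun hc => hω fun m Z => ?_
      have e : 4 * s / √ε ≤ 64 * s * √ε := by
        rw [div_le_iff₀ hr, mul_assoc (64 * s), hr2]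
        nlinarith
      obtain ⟨h₁, h₂⟩ := trimmedMean_sub_le_of_few_above (m := m) (Z := Z) hM hM0 hε hε2 hB hc
      exact ⟨fun hZ => (h₁ hZ).trans e, fun hZ => (h₂ hZ).trans e⟩
    · have := Real.exp_pos (-(3 / 8 * (ε * (M / 2 : ℕ))))
      linarith

lemma six_mul_exp_le {δ K : ℝ} (hδ : 0 < δ) (hδ1 : δ ≤ 1) (hK : 12 * Real.log (4 / δ) ≤ K) :
    3 * Real.exp (-(3 / 8 * K)) + 3 * Real.exp (-(3 / 8 * K)) ≤ δ := by
  have hlog : 0 ≤ Real.log (4 / δ) :=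
    Real.log_nonneg ((le_div_iff₀ hδ).2 (by linarith))
  have h₁ : Real.exp (-(3 / 8 * K)) ≤ Real.exp (-Real.log (4 / δ) + -Real.log (4 / δ)) :=
    Real.exp_le_exp.2 (by linarith)
  rw [Real.exp_add, Real.exp_neg (Real.log _), Real.exp_log (by positivity), inv_div] at h₁
  nlinarith

/-- Performance of the trimmed mean for data with positive variance bound; see
`measure_trimmedMean_dev_le`. -/
lemma measure_trimmedMean_dev_le_of_pos (hM : Even M) (hM0 : 0 < M)
    (hmeas : ∀ i ∉ B, Measurable (X i))
    (hind : iIndepFun (fun i : {i : Fin M // i ∉ B} => X i) P)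
    (hlaw : ∀ i ∉ B, P.map (X i) = ν) (hs : 0 < s) (hε : 0 < ε) (hε2 : ε ≤ 1 / 2)
    (hB : (B.card : ℝ) ≤ ε * (M / 2 : ℕ) / 4) (h2 : MemLp id 2 ν)
    (hmean : ∫ x, x ∂ν = m) (hvar : ∫ x, (x - m) ^ 2 ∂ν ≤ s ^ 2) {δ : ℝ} (hδ : 0 < δ)
    (hδ1 : δ ≤ 1) (hK : 12 * Real.log (4 / δ) ≤ ε * (M / 2 : ℕ)) :
    P {ω | ∃ Z : Fin M → ℝ, (∀ i ∉ B, Z i = X i ω) ∧ 64 * s * √ε < |trimmedMean ε Z - m|} ≤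
      ENNReal.ofReal δ := by
  have h1 : Integrable (fun x : ℝ => x) ν := h2.integrable (by norm_num)
  have hsub : Measurable fun x : ℝ => x - m := by fun_prop
  have hsub' : Measurable fun x : ℝ => m - x := by fun_prop
  have : IsProbabilityMeasure (ν.map fun x => x - m) :=
    Measure.isProbabilityMeasure_map hsub.aemeasurable
  have : IsProbabilityMeasure (ν.map fun x => m - x) :=
    Measure.isProbabilityMeasure_map hsub'.aemeasurable
  have hup := measure_one_sided_le (P := P) (B := B) (X := fun i ω => X i ω - m)
    (ν := ν.map fun x => x - m) (s := s) (ε := ε) hM hM0 (fun i hi => hsub.comp (hmeas i hi))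
    (hind.comp (fun _ => fun x => x - m) (fun _ => hsub))
  have hlo := measure_one_sided_le (P := P) (B := B) (X := fun i ω => m - X i ω)
    (ν := ν.map fun x => m - x) (s := s) (ε := ε) hM hM0 (fun i hi => hsub'.comp (hmeas i hi))
    (hind.comp (fun _ => fun x => m - x) (fun _ => hsub'))
  replace hup := hup
    (fun i hi => by rw [← hlaw i hi, Measure.map_map hsub (hmeas i hi)]; rfl) hs hε hε2 hB
    ((memLp_map_measure_iff aestronglyMeasurable_id hsub.aemeasurable).2
      (h2.sub (memLp_const m)))
    (by
      rw [integral_map hsub.aemeasurable (by fun_prop),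
        integral_sub h1 (integrable_const _), hmean]
      simp)
    (by
      rw [integral_map hsub.aemeasurable (by fun_prop)]
      exact hvar)
  replace hlo := hlo
    (fun i hi => by rw [← hlaw i hi, Measure.map_map hsub' (hmeas i hi)]; rfl) hs hε hε2 hB
    ((memLp_map_measure_iff aestronglyMeasurable_id hsub'.aemeasurable).2
      ((memLp_const m).sub h2))
    (by
      rw [integral_map hsub'.aemeasurable (by fun_prop),
        integral_sub (integrable_const _) h1, hmean]
      simp)
    (by
      rw [integral_map hsub'.aemeasurable (by fun_prop)]
      simp only [sub_sq_comm m]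
      exact hvar)
  refine (measure_mono ?_).trans ((measure_union_le _ _).trans ((add_le_add hup hlo).trans ?_))
  · rintro ω ⟨Z, hZ, hlt⟩
    by_contra hcon
    simp only [Set.mem_union, Set.mem_ofPred_eq, not_or, not_not] at hcon
    have h₁ := (hcon.1 m Z).1 fun i hi => by rw [hZ i hi]
    have h₂ := (hcon.2 m Z).2 fun i hi => by rw [hZ i hi]
    exact hlt.not_ge (abs_sub_le_iff.2 ⟨h₁, h₂⟩)
  · rw [← ENNReal.ofReal_add (by positivity) (by positivity)]
    exact ENNReal.ofReal_le_ofReal (six_mul_exp_le hδ hδ1 hK)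

/-- **Performance of the trimmed mean.** Let the entries of the normal agents be independent with
common law `ν`, of mean `m` and variance at most `s²`. Outside an event of probability `δ`, the
trimmed mean is within `64 s √ε` of `m`, whatever entries the Byzantine agents choose after seeing
the normal ones. -/
lemma measure_trimmedMean_dev_le (hM : Even M) (hM0 : 0 < M)
    (hmeas : ∀ i ∉ B, Measurable (X i))
    (hind : iIndepFun (fun i : {i : Fin M // i ∉ B} => X i) P)
    (hlaw : ∀ i ∉ B, P.map (X i) = ν) (hs : 0 ≤ s) (hε : 0 < ε) (hε2 : ε ≤ 1 / 2)
    (hB : (B.card : ℝ) ≤ ε * (M / 2 : ℕ) / 4) (h2 : MemLp id 2 ν)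
    (hmean : ∫ x, x ∂ν = m) (hvar : ∫ x, (x - m) ^ 2 ∂ν ≤ s ^ 2) {δ : ℝ} (hδ : 0 < δ)
    (hδ1 : δ ≤ 1) (hK : 12 * Real.log (4 / δ) ≤ ε * (M / 2 : ℕ)) :
    P {ω | ∃ Z : Fin M → ℝ, (∀ i ∉ B, Z i = X i ω) ∧ 64 * s * √ε < |trimmedMean ε Z - m|} ≤
      ENNReal.ofReal δ := by
  -- for `s = 0`, the event is the increasing union of the events for the levels `s + 1 / (k + 1)`
  have hr : 0 < √ε := Real.sqrt_pos.2 hε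
  let E : ℕ → Set Ω' := fun k => {ω | ∃ Z : Fin M → ℝ, (∀ i ∉ B, Z i = X i ω) ∧
    64 * (s + 1 / (k + 1)) * √ε < |trimmedMean ε Z - m|}
  have hmono : Monotone E := fun k l hkl ω => by
    rintro ⟨Z, hZ, h⟩
    refine ⟨Z, hZ, lt_of_le_of_lt ?_ h⟩
    have := Nat.one_div_le_one_div (α := ℝ) hkl
    gcongr
  have hE : {ω | ∃ Z : Fin M → ℝ, (∀ i ∉ B, Z i = X i ω) ∧
      64 * s * √ε < |trimmedMean ε Z - m|} ⊆ ⋃ k, E k := by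
    rintro ω ⟨Z, hZ, h⟩
    obtain ⟨k, hk⟩ := exists_nat_one_div_lt
      (show 0 < (|trimmedMean ε Z - m| - 64 * s * √ε) / (64 * √ε) from
        div_pos (sub_pos.2 h) (by positivity))
    rw [lt_div_iff₀ (by positivity)] at hk
    exact Set.mem_iUnion.2 ⟨k, Z, hZ, by linarith⟩
  refine (measure_mono hE).trans ?_
  rw [hmono.measure_iUnion]
  refine iSup_le fun k => ?_
  have hk : (0 : ℝ) < 1 / (k + 1) := by positivity
  exact measure_trimmedMean_dev_le_of_pos hM hM0 hmeas hind hlaw (by linarith) hε hε2 hB h2 hmean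
    (hvar.trans (pow_le_pow_left₀ hs (by linarith) 2)) hδ hδ1 hK

end Probability

/-! ### The robust gradient at a random query point -/

section Oracle

variable {n m k M : ℕ} {Ξ Ω : Type*} [MeasurableSpace Ξ] [mΩ : MeasurableSpace Ω]
  {P : Measure Ω} [IsProbabilityMeasure P] {D : Measure Ξ} [IsProbabilityMeasure D]
  {X : Set (Vec n)} {Y : Set (Vec m)} {G : Vec n → Vec m → Vec k} {g : Vec n → Vec m → Ξ → Vec k}
  {σ : Fin k → ℝ} {B : Finset (Fin M)}

/-- At a fixed query point, for every response of the Byzantine agents to the samples. -/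
lemma IsStochasticOracle.measure_pi_dev_le (hg : IsStochasticOracle D X Y G g σ)
    {x : Vec n} {y : Vec m} (hx : x ∈ X) (hy : y ∈ Y) (hM : Even M) (hM0 : 0 < M) {ε δ : ℝ}
    (hε : 0 < ε) (hε2 : ε ≤ 1 / 2) (hB : (B.card : ℝ) ≤ ε * (M / 2 : ℕ) / 4) (hδ : 0 < δ)
    (hδ1 : δ ≤ 1) (hK : 12 * Real.log (4 / δ) ≤ ε * (M / 2 : ℕ)) (j : Fin k) :
    Measure.pi (fun _ : {i : Fin M // i ∉ B} => D) {ξ | ∃ Z : Fin M → ℝ,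
        (∀ i : {i : Fin M // i ∉ B}, Z i = g x y (ξ i) j) ∧
        64 * |σ j| * √ε < |trimmedMean ε Z - ∫ s, g x y s j ∂D|} ≤ ENNReal.ofReal δ := by
  have hu : Measurable fun s => g x y s j := by
    have h1 : Measurable fun s : Ξ => (x, y, s) := by fun_prop
    have := hg.measurable.comp h1
    fun_prop
  have : IsProbabilityMeasure (D.map fun s => g x y s j) :=
    Measure.isProbabilityMeasure_map hu.aemeasurable
  let V : Fin M → ({i : Fin M // i ∉ B} → Ξ) → ℝ := fun i ξ =>
    if h : i ∉ B then g x y (ξ ⟨i, h⟩) j else 0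
  have hV : ∀ i (h : i ∉ B), V i = fun ξ => g x y (ξ ⟨i, h⟩) j := fun i h => by
    funext ξ
    exact dif_pos h
  have key := measure_trimmedMean_dev_le (P := Measure.pi fun _ : {i : Fin M // i ∉ B} => D)
    (B := B) (X := V) (ν := D.map fun s => g x y s j) (s := |σ j|) (ε := ε)
    (m := ∫ s, g x y s j ∂D) hM hM0
    (fun i hi => by rw [hV i hi]; exact hu.comp (measurable_pi_apply _))
    (by
      have := iIndepFun_pi (ι := {i : Fin M // i ∉ B}) (μ := fun _ => D)
        (X := fun _ s => g x y s j) (fun _ => hu.aemeasurable)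
      refine this.congr fun i => ae_of_all _ fun ξ => ?_
      simp only [hV i i.2])
    (fun i hi => by
      rw [hV i hi]
      have h₁ : (fun ξ : {i : Fin M // i ∉ B} → Ξ => g x y (ξ ⟨i, hi⟩) j) =
        (fun s => g x y s j) ∘ Function.eval ⟨i, hi⟩ := rfl
      rw [h₁, ← Measure.map_map hu (measurable_pi_apply _),
        (measurePreserving_eval (fun _ : {i : Fin M // i ∉ B} => D) ⟨i, hi⟩).map_eq])
    (abs_nonneg _) hε hε2 hB
    ((memLp_map_measure_iff aestronglyMeasurable_id hu.aemeasurable).2 (hg.memLp x hx y hy j))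
    (integral_map hu.aemeasurable aestronglyMeasurable_id)
    (by
      rw [integral_map hu.aemeasurable (by fun_prop), hg.unbiased x hx y hy j, sq_abs]
      exact hg.variance_le x hx y hy j) hδ hδ1 hK
  refine (measure_mono ?_).trans key
  rintro ξ ⟨Z, hZ, h⟩
  refine ⟨Z, fun i hi => ?_, h⟩
  rw [hV i hi]
  exact hZ ⟨i, hi⟩

/-- At a random query point `w` that is independent of the samples of the normal agents. The
messages `b` of the Byzantine agents are arbitrary: rational messages realize the worst case
up to monotonicity, which makes the exceptional set measurable. -/
lemma IsStochasticOracle.measure_dev_le (hg : IsStochasticOracle D X Y G g σ)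
    {w : Ω → Vec n × Vec m} (hwm : Measurable w) (hwX : ∀ ω, (w ω).1 ∈ X)
    (hwY : ∀ ω, (w ω).2 ∈ Y) {ξ : Fin M → Ω → Ξ} (hξ : ∀ i ∉ B, Measurable (ξ i))
    (hlaw : ∀ i ∉ B, P.map (ξ i) = D)
    (hind : iIndepFun (fun i : {i : Fin M // i ∉ B} => ξ i) P)
    (hfresh : IndepFun w (fun ω (i : {i : Fin M // i ∉ B}) => ξ i ω) P)
    (b : Fin M → Ω → Vec k) (hM : Even M) (hM0 : 0 < M) {ε δ : ℝ}
    (hε : 0 < ε) (hε2 : ε ≤ 1 / 2) (hB : (B.card : ℝ) ≤ ε * (M / 2 : ℕ) / 4) (hδ : 0 < δ)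
    (hδ1 : δ ≤ 1) (hK : 12 * Real.log (4 / δ) ≤ ε * (M / 2 : ℕ)) (j : Fin k) :
    P {ω | 64 * |σ j| * √ε < |trim ε (received B g (w ω).1 (w ω).2 (fun i => ξ i ω)
        fun i => b i ω) j - G (w ω).1 (w ω).2 j|} ≤ ENNReal.ofReal δ := by
  classical
  let ι := {i : Fin M // i ∉ B}
  let Z : (Fin M → ℚ) → (Vec n × Vec m) × (ι → Ξ) → Fin M → ℝ := fun q p i =>
    if h : i ∈ B then (q i : ℝ) else g p.1.1 p.1.2 (p.2 ⟨i, h⟩) j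
  let S : Set ((Vec n × Vec m) × (ι → Ξ)) := ⋃ q : Fin M → ℚ,
    {p | 64 * |σ j| * √ε < |trimmedMean ε (Z q p) - ∫ s, g p.1.1 p.1.2 s j ∂D|}
  have hgj : Measurable fun p : Vec n × Vec m × Ξ => g p.1 p.2.1 p.2.2 j := by
    have := hg.measurable
    fun_prop
  have hGm : Measurable fun p : Vec n × Vec m => ∫ s, g p.1 p.2 s j ∂D := by
    have h1 : Measurable fun p : (Vec n × Vec m) × Ξ => (p.1.1, p.1.2, p.2) := by fun_prop
    exact ((hgj.comp h1).stronglyMeasurable.integral_prod_right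
      (f := fun (p : Vec n × Vec m) s => g p.1 p.2 s j)).measurable
  have hZm : ∀ q, Measurable (Z q) := fun q => measurable_pi_lambda _ fun i => by
    by_cases h : i ∈ B
    · simp only [Z, h, dif_pos]
      exact measurable_const
    · simp only [Z, h, dif_neg, not_false_eq_true]
      have h1 : Measurable fun p : (Vec n × Vec m) × (ι → Ξ) =>
        (p.1.1, p.1.2, p.2 ⟨i, h⟩) := by fun_prop
      exact hgj.comp h1
  have hS : MeasurableSet S := MeasurableSet.iUnion fun q =>
    measurableSet_lt measurable_const
      (((measurable_trimmedMean ε).comp (hZm q)).sub (hGm.comp measurable_fst)).abs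
  have hξm : Measurable fun ω (i : ι) => ξ i ω := measurable_pi_lambda _ fun i => hξ i i.2
  have hpi : P.map (fun ω (i : ι) => ξ i ω) = Measure.pi fun _ => D := by
    rw [(iIndepFun_iff_map_fun_eq_pi_map (fun i : ι => (hξ i i.2).aemeasurable)).1 hind]
    congr 1
    funext i
    exact hlaw i i.2
  have hprod : P.map (fun ω => (w ω, fun i : ι => ξ i ω)) =
      (P.map w).prod (Measure.pi fun _ : ι => D) := by
    rw [(indepFun_iff_map_prod_eq_prod_map_map hwm.aemeasurable hξm.aemeasurable).1 hfresh, hpi]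
  have hsub : {ω | 64 * |σ j| * √ε < |trim ε (received B g (w ω).1 (w ω).2 (fun i => ξ i ω)
        fun i => b i ω) j - G (w ω).1 (w ω).2 j|} ⊆
      (fun ω => (w ω, fun i : ι => ξ i ω)) ⁻¹' S := by
    intro ω hω
    rw [Set.mem_ofPred_eq, ← hg.unbiased _ (hwX ω) _ (hwY ω) j] at hω
    set V : Fin M → ℝ := fun i => received B g (w ω).1 (w ω).2 (fun i => ξ i ω)
      (fun i => b i ω) i j with hV
    have htrim : trim ε (received B g (w ω).1 (w ω).2 (fun i => ξ i ω) fun i => b i ω) j =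
      trimmedMean ε V := rfl
    rw [htrim] at hω
    have hVB : ∀ i (h : i ∉ B), V i = g (w ω).1 (w ω).2 (ξ i ω) j := fun i h => by
      simp only [hV, received, if_neg h]
    rcases lt_abs.1 hω with h | h
    · have hq : ∀ i, ∃ q : ℚ, V i < q := fun i => exists_rat_gt _
      choose q hq using hq
      refine Set.mem_iUnion.2 ⟨q, lt_abs.2 (Or.inl (h.trans_le ?_))⟩
      refine sub_le_sub_right (trimmedMean_mono hε hε2 fun i => ?_) _
      by_cases hi : i ∈ B
      · simp only [Z, hi, dif_pos]
        exact (hq i).le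
      · simp only [Z, hi, dif_neg, not_false_eq_true]
        exact (hVB i hi).le
    · have hq : ∀ i, ∃ q : ℚ, (q : ℝ) < V i := fun i => exists_rat_lt _
      choose q hq using hq
      refine Set.mem_iUnion.2 ⟨q, lt_abs.2 (Or.inr (h.trans_le ?_))⟩
      refine neg_le_neg (sub_le_sub_right (trimmedMean_mono hε hε2 fun i => ?_) _)
      by_cases hi : i ∈ B
      · simp only [Z, hi, dif_pos]
        exact (hq i).le
      · simp only [Z, hi, dif_neg, not_false_eq_true]
        exact (hVB i hi).ge
  have hsec : ∀ z : Vec n × Vec m, z.1 ∈ X → z.2 ∈ Y →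
      Measure.pi (fun _ : ι => D) (Prod.mk z ⁻¹' S) ≤ ENNReal.ofReal δ := by
    intro z hzX hzY
    refine (measure_mono ?_).trans
      (hg.measure_pi_dev_le hzX hzY hM hM0 hε hε2 hB hδ hδ1 hK j)
    intro s hs
    obtain ⟨q, hq⟩ := Set.mem_iUnion.1 hs
    exact ⟨Z q (z, s), fun i => dif_neg i.2, hq⟩
  calc P _ ≤ P ((fun ω => (w ω, fun i : ι => ξ i ω)) ⁻¹' S) := measure_mono hsub
    _ = P.map (fun ω => (w ω, fun i : ι => ξ i ω)) S :=
      (Measure.map_apply (hwm.prodMk hξm) hS).symm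
    _ = ∫⁻ z, Measure.pi (fun _ : ι => D) (Prod.mk z ⁻¹' S) ∂(P.map w) := by
      rw [hprod, Measure.prod_apply hS]
    _ = ∫⁻ ω, Measure.pi (fun _ : ι => D) (Prod.mk (w ω) ⁻¹' S) ∂P :=
      lintegral_map (measurable_measure_prodMk_left hS) hwm
    _ ≤ ∫⁻ _, ENNReal.ofReal δ ∂P := lintegral_mono fun ω => hsec _ (hwX ω) (hwY ω)
    _ = ENNReal.ofReal δ := by simp

end Oracle

/-! ### Euclidean projections -/

section Projection

variable {n : ℕ} {X : Set (Vec n)}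

lemma proj_spec (hne : X.Nonempty) (hc : IsCompact X) (v : Vec n) :
    proj X v ∈ X ∧ ∀ q ∈ X, ‖v - proj X v‖ ≤ ‖v - q‖ := by
  obtain ⟨p, hp, hmin⟩ := hc.exists_isMinOn hne (f := fun q => ‖v - q‖) (by fun_prop)
  exact Classical.epsilon_spec (p := fun p => p ∈ X ∧ ∀ q ∈ X, ‖v - p‖ ≤ ‖v - q‖) ⟨p, hp, hmin⟩

lemma inner_sub_proj_le_zero (hne : X.Nonempty) (hc : IsCompact X) (hconv : Convex ℝ X)
    (v : Vec n) {q : Vec n} (hq : q ∈ X) : inner ℝ (v - proj X v) (q - proj X v) ≤ 0 := by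
  obtain ⟨h₁, h₂⟩ := proj_spec hne hc v
  have : Nonempty X := hne.to_subtype
  refine (norm_eq_iInf_iff_real_inner_le_zero hconv h₁).1 (le_antisymm ?_ ?_) q hq
  · exact le_ciInf fun q => h₂ q q.2
  · exact ciInf_le ⟨0, by rintro _ ⟨q, rfl⟩; exact norm_nonneg _⟩ (⟨_, h₁⟩ : X)

lemma continuous_proj (hne : X.Nonempty) (hc : IsCompact X) (hconv : Convex ℝ X) :
    Continuous (proj X) := by
  refine LipschitzWith.continuous (K := 1) (LipschitzWith.of_dist_le_mul fun u v => ?_)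
  have h₁ := inner_sub_proj_le_zero hne hc hconv u (proj_spec hne hc v).1
  have h₂ := inner_sub_proj_le_zero hne hc hconv v (proj_spec hne hc u).1
  rw [dist_eq_norm, dist_eq_norm, NNReal.coe_one, one_mul]
  set p := proj X u
  set q := proj X v
  have h₃ : inner ℝ (u - v) (p - q) = ‖p - q‖ ^ 2 - inner ℝ (u - p) (q - p) -
      inner ℝ (v - q) (p - q) := by
    rw [← real_inner_self_eq_norm_sq]
    simp only [inner_sub_left, inner_sub_right]
    ring
  have h₄ := real_inner_le_norm (u - v) (p - q)
  have h₅ := norm_nonneg (p - q)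
  have h₆ := norm_nonneg (u - v)
  by_contra! hlt
  nlinarith

/-- One extra-gradient step in one variable: `u` is the gradient used for the mid-point and `v` the
one used for the new iterate. -/
lemma inner_proj_le (hne : X.Nonempty) (hc : IsCompact X) (hconv : Convex ℝ X) (η : ℝ)
    (x u v : Vec n) {c : Vec n} (hcX : c ∈ X) :
    2 * η * inner ℝ v (proj X (x - η • u) - c) ≤
      ‖x - c‖ ^ 2 - ‖proj X (x - η • v) - c‖ ^ 2 -
        ‖proj X (x - η • u) - proj X (x - η • v)‖ ^ 2 - ‖proj X (x - η • u) - x‖ ^ 2 +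
        2 * η * inner ℝ (v - u) (proj X (x - η • u) - proj X (x - η • v)) := by
  have h₁ := inner_sub_proj_le_zero hne hc hconv (x - η • v) hcX
  have h₂ := inner_sub_proj_le_zero hne hc hconv (x - η • u) (proj_spec hne hc (x - η • v)).1
  set p := proj X (x - η • u)
  set q := proj X (x - η • v)
  simp only [← real_inner_self_eq_norm_sq, inner_sub_left, inner_sub_right, real_inner_smul_left]
    at h₁ h₂ ⊢
  have c₁ := real_inner_comm x c
  have c₂ := real_inner_comm q c
  have c₃ := real_inner_comm p q
  have c₄ := real_inner_comm x p
  have c₅ := real_inner_comm x q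
  have c₆ := real_inner_comm p c
  linarith

end Projection

/-! ### Contraction of the extra-gradient step -/

/-- Quadratic growth of a strongly convex function at its minimizer. -/
lemma quadratic_growth {n : ℕ} {X : Set (Vec n)} (hconv : Convex ℝ X) {φ : Vec n → ℝ}
    {G : Vec n → Vec n} {μ : ℝ}
    (hφ : ∀ x₁ ∈ X, ∀ x₂ ∈ X, φ x₁ + inner ℝ (G x₁) (x₂ - x₁) + μ / 2 * ‖x₂ - x₁‖ ^ 2 ≤ φ x₂)
    {xs : Vec n} (hxs : xs ∈ X) (hmin : ∀ x ∈ X, φ xs ≤ φ x) {x : Vec n} (hx : x ∈ X) :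
    φ xs + μ / 2 * ‖x - xs‖ ^ 2 ≤ φ x := by
  by_contra! hlt
  have hgap := hmin x hx
  set A := μ / 2 * ‖x - xs‖ ^ 2 with hA
  have hApos : 0 < A := by linarith
  -- compare with the point a fraction `θ` of the way from `xs` to `x`
  set θ := (A - (φ x - φ xs)) / (2 * A) with hθ
  have hθ0 : 0 < θ := div_pos (by linarith) (by positivity)
  have hθ1 : θ < 1 := (div_lt_one (by positivity)).2 (by linarith)
  have hθA : θ * (2 * A) = A - (φ x - φ xs) := div_mul_cancel₀ _ (by positivity)
  set p := xs + θ • (x - xs) with hp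
  have hpX : p ∈ X := hconv.add_smul_sub_mem hxs hx ⟨hθ0.le, hθ1.le⟩
  have h₁ := hφ p hpX x hx
  have h₂ := hφ p hpX xs hxs
  have h₃ := hmin p hpX
  have e₁ : x - p = (1 - θ) • (x - xs) := by rw [hp, sub_smul, one_smul]; abel
  have e₂ : xs - p = (-θ) • (x - xs) := by rw [hp, neg_smul]; abel
  rw [e₁, real_inner_smul_right, norm_smul, mul_pow, Real.norm_eq_abs, sq_abs] at h₁
  rw [e₂, real_inner_smul_right, norm_smul, mul_pow, Real.norm_eq_abs, sq_abs] at h₂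
  set I := inner ℝ (G p) (x - xs)
  have h₁' : φ p + (1 - θ) * I + (1 - θ) ^ 2 * A ≤ φ x := by rw [hA]; linarith
  have h₂' : φ p + -θ * I + (-θ) ^ 2 * A ≤ φ xs := by rw [hA]; linarith
  have h₄ : θ * ((1 - θ) * A) ≤ θ * (φ x - φ xs) := by
    have i₁ := mul_le_mul_of_nonneg_left h₁' hθ0.le
    have i₂ := mul_le_mul_of_nonneg_left h₂' (sub_nonneg.2 hθ1.le)
    nlinarith
  have h₅ := le_of_mul_le_mul_left h₄ hθ0
  linarith

section Objective

variable {n m : ℕ} {X : Set (Vec n)} {Y : Set (Vec m)} {f : Vec n → Vec m → ℝ}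
  {Gx : Vec n → Vec m → Vec n} {Gy : Vec n → Vec m → Vec m} {L μ : ℝ}

/-- The gradient field of the saddle-point problem is strongly monotone relative to the saddle
point. -/
lemma IsStronglyConvexConcave.le_inner (h : IsStronglyConvexConcave X Y μ f Gx Gy)
    (hX : Convex ℝ X) (hY : Convex ℝ Y) {xs : Vec n} {ys : Vec m} (hxs : xs ∈ X) (hys : ys ∈ Y)
    (hsp : IsSaddlePointOn X Y f xs ys) {x : Vec n} {y : Vec m} (hx : x ∈ X) (hy : y ∈ Y) :
    μ * (‖x - xs‖ ^ 2 + ‖y - ys‖ ^ 2) ≤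
      inner ℝ (Gx x y) (x - xs) - inner ℝ (Gy x y) (y - ys) := by
  have g₁ := quadratic_growth hX (φ := fun x => f x ys) (G := fun x => Gx x ys)
    (fun x₁ h₁ x₂ h₂ => (h x₁ h₁ x₂ h₂ ys hys ys hys).1) hxs
    (fun x hx => hsp x hx ys hys) hx
  have g₂ := quadratic_growth hY (φ := fun y => - f xs y) (G := fun y => - Gy xs y) (μ := μ)
    (fun y₁ h₁ y₂ h₂ => by
      have := (h xs hxs xs hxs y₁ h₁ y₂ h₂).2
      simp only [inner_neg_left]
      linarith) hys
    (fun y hy => neg_le_neg (hsp xs hxs y hy)) hy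
  have h₁ := (h x hx xs hxs y hy ys hys).1
  have h₂ := (h x hx xs hxs y hy ys hys).2
  rw [← neg_sub x xs, inner_neg_right, norm_neg] at h₁
  rw [← neg_sub y ys, inner_neg_right, norm_neg] at h₂
  linarith

lemma le_of_inner_le {E : Type*} [NormedAddCommGroup E] [InnerProductSpace ℝ E] {a d : E}
    (hd : d ≠ 0) (h₁ : μ * ‖d‖ ^ 2 ≤ inner ℝ a d) (h₂ : ‖a‖ ≤ L * ‖d‖) : μ ≤ L := by
  have hpos : 0 < ‖d‖ := norm_pos_iff.2 hd
  have h₃ := real_inner_le_norm a d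
  have h₄ : μ * ‖d‖ ^ 2 ≤ L * ‖d‖ ^ 2 := by nlinarith
  exact le_of_mul_le_mul_right h₄ (by positivity)

/-- Strong convexity cannot exceed smoothness, unless the domain is a single point. -/
lemma IsStronglyConvexConcave.le_smoothness (h : IsStronglyConvexConcave X Y μ f Gx Gy)
    (hL : AreSmooth X Y L Gx Gy) {x₁ x₂ : Vec n} {y₁ y₂ : Vec m} (hx₁ : x₁ ∈ X) (hx₂ : x₂ ∈ X)
    (hy₁ : y₁ ∈ Y) (hy₂ : y₂ ∈ Y) (hne : x₁ ≠ x₂ ∨ y₁ ≠ y₂) : μ ≤ L := by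
  rcases hne with hne | hne
  · have i₁ := (h x₁ hx₁ x₂ hx₂ y₁ hy₁ y₁ hy₁).1
    have i₂ := (h x₂ hx₂ x₁ hx₁ y₁ hy₁ y₁ hy₁).1
    have i₃ := (hL x₁ hx₁ x₂ hx₂ y₁ hy₁ y₁ hy₁).1
    refine le_of_inner_le (sub_ne_zero.2 hne) (a := Gx x₁ y₁ - Gx x₂ y₁) ?_ (by simpa using i₃)
    rw [inner_sub_left]
    rw [← neg_sub x₁ x₂, inner_neg_right, norm_neg] at i₁
    linarith
  · have i₁ := (h x₁ hx₁ x₁ hx₁ y₁ hy₁ y₂ hy₂).2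
    have i₂ := (h x₁ hx₁ x₁ hx₁ y₂ hy₂ y₁ hy₁).2
    have i₃ := (hL x₁ hx₁ x₁ hx₁ y₁ hy₁ y₂ hy₂).2
    refine le_of_inner_le (sub_ne_zero.2 hne) (a := -(Gy x₁ y₁ - Gy x₁ y₂)) ?_
      (by rw [norm_neg]; simpa using i₃)
    rw [inner_neg_left, inner_sub_left]
    rw [← neg_sub y₁ y₂, inner_neg_right, norm_neg] at i₁
    linarith

lemma inner_le_of_norm_le {E : Type*} [NormedAddCommGroup E] [InnerProductSpace ℝ E] {a d : E}
    {p q : ℝ} (ha : ‖a‖ ≤ p) (hd : ‖d‖ ≤ q) : inner ℝ a d ≤ p * q :=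
  (real_inner_le_norm a d).trans
    (mul_le_mul ha hd (norm_nonneg _) ((norm_nonneg _).trans ha))

lemma mul_add_mul_add_le {c p q r t : ℝ} (hc : c ≤ 1 / 4) (hp : 0 ≤ p) (hq : 0 ≤ q)
    (hr : 0 ≤ r) (ht : 0 ≤ t) :
    2 * c * ((p + q) * (r + t)) ≤ 1 / 2 * (p ^ 2 + q ^ 2 + r ^ 2 + t ^ 2) := by
  have b₁ : 2 * c * ((p + q) * (r + t)) ≤ 1 / 2 * ((p + q) * (r + t)) :=
    mul_le_mul_of_nonneg_right (by linarith) (by positivity)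
  have b₂ : (p + q) * (r + t) ≤ p ^ 2 + q ^ 2 + r ^ 2 + t ^ 2 := by
    nlinarith [sq_nonneg (p - q), sq_nonneg (r - t), sq_nonneg (p + q - r - t)]
  linarith

/-- A full extra-gradient step with gradient errors at most `Δ` contracts the squared distance to
the saddle point by the factor `1 - ημ`, up to an error `12 η Δ D`. The slack `-‖ẑ - z‖² / 2` that
remains after the Lipschitz terms are absorbed pays for passing from the mid-point
`ẑ` to the iterate `z` in the strong monotonicity. -/
lemma extragradient_step (hX : Convex ℝ X) (hXc : IsCompact X) (hY : Convex ℝ Y)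
    (hYc : IsCompact Y) (hLpos : 0 < L) (hL : AreSmooth X Y L Gx Gy) (hμ : 0 < μ) (hμL : μ ≤ L)
    (hf : IsStronglyConvexConcave X Y μ f Gx Gy) {xs x : Vec n} {ys y : Vec m}
    (hxs : xs ∈ X) (hys : ys ∈ Y) (hsp : IsSaddlePointOn X Y f xs ys) (hx : x ∈ X) (hy : y ∈ Y)
    {η Δ D : ℝ} (hη : 0 < η) (hηL : η ≤ 1 / (4 * L))
    (hDX : ∀ p ∈ X, ∀ q ∈ X, ‖p - q‖ ≤ D) (hDY : ∀ p ∈ Y, ∀ q ∈ Y, ‖p - q‖ ≤ D)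
    {u v x' x'' : Vec n} {u' v' y' y'' : Vec m}
    (hx' : x' = proj X (x - η • u)) (hy' : y' = proj Y (y + η • u'))
    (hx'' : x'' = proj X (x - η • v)) (hy'' : y'' = proj Y (y + η • v'))
    (hu : ‖u - Gx x y‖ ≤ Δ) (hu' : ‖u' - Gy x y‖ ≤ Δ)
    (hv : ‖v - Gx x' y'‖ ≤ Δ) (hv' : ‖v' - Gy x' y'‖ ≤ Δ) :
    ‖xs - x''‖ ^ 2 + ‖ys - y''‖ ^ 2 ≤
      (1 - η * μ) * (‖xs - x‖ ^ 2 + ‖ys - y‖ ^ 2) + 12 * η * Δ * D := by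
  have hXne : X.Nonempty := ⟨x, hx⟩
  have hYne : Y.Nonempty := ⟨y, hy⟩
  have s₁ := inner_proj_le hXne hXc hX η x u v hxs
  have s₂ := inner_proj_le hYne hYc hY η y (-u') (-v') hys
  rw [smul_neg, smul_neg, sub_neg_eq_add, sub_neg_eq_add] at s₂
  have mx' : x' ∈ X := hx' ▸ (proj_spec hXne hXc _).1
  have my' : y' ∈ Y := hy' ▸ (proj_spec hYne hYc _).1
  have mx'' : x'' ∈ X := hx'' ▸ (proj_spec hXne hXc _).1
  have my'' : y'' ∈ Y := hy'' ▸ (proj_spec hYne hYc _).1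
  rw [← hx', ← hx''] at s₁
  rw [← hy', ← hy''] at s₂
  have hmono := hf.le_inner hX hY hxs hys hsp mx' my'
  obtain ⟨l₁, l₂⟩ := hL x' mx' x hx y' my' y hy
  -- the errors of the robust gradients
  set e₁ := u - Gx x y with he₁
  set e₂ := v - Gx x' y' with he₂
  set e₃ := u' - Gy x y with he₃
  set e₄ := v' - Gy x' y' with he₄
  have n₁ := inner_le_of_norm_le (a := -e₂) (d := x' - xs) ((norm_neg _).trans_le hv)
    (hDX _ mx' _ hxs)
  have n₂ := inner_le_of_norm_le (a := e₄) (d := y' - ys) hv' (hDY _ my' _ hys)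
  have n₃ := inner_le_of_norm_le (a := e₂) (d := x' - x'') hv (hDX _ mx' _ mx'')
  have n₄ := inner_le_of_norm_le (a := -e₁) (d := x' - x'') ((norm_neg _).trans_le hu)
    (hDX _ mx' _ mx'')
  have n₅ := inner_le_of_norm_le (a := -e₄) (d := y' - y'') ((norm_neg _).trans_le hv')
    (hDY _ my' _ my'')
  have n₆ := inner_le_of_norm_le (a := e₃) (d := y' - y'') hu' (hDY _ my' _ my'')
  have g₁ := inner_le_of_norm_le l₁ (le_refl ‖x' - x''‖)
  have g₂ := inner_le_of_norm_le (a := -(Gy x' y' - Gy x y)) ((norm_neg _).trans_le l₂)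
    (le_refl ‖y' - y''‖)
  have hv_eq : v = Gx x' y' + e₂ := by rw [he₂]; abel
  have hv'_eq : v' = Gy x' y' + e₄ := by rw [he₄]; abel
  have hu_eq : u = Gx x y + e₁ := by rw [he₁]; abel
  have hu'_eq : u' = Gy x y + e₃ := by rw [he₃]; abel
  clear_value e₁ e₂ e₃ e₄
  subst hv_eq hv'_eq hu_eq hu'_eq
  rw [norm_sub_rev xs x'', norm_sub_rev ys y'', norm_sub_rev xs x, norm_sub_rev ys y]
  -- pass from the mid-point to the base point
  have t₁ : ‖x - xs‖ ^ 2 ≤ 2 * ‖x' - xs‖ ^ 2 + 2 * ‖x' - x‖ ^ 2 := by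
    have := norm_sub_le_norm_sub_add_norm_sub x x' xs
    rw [norm_sub_rev x x'] at this
    nlinarith [norm_nonneg (x - xs), sq_nonneg (‖x' - xs‖ - ‖x' - x‖)]
  have t₂ : ‖y - ys‖ ^ 2 ≤ 2 * ‖y' - ys‖ ^ 2 + 2 * ‖y' - y‖ ^ 2 := by
    have := norm_sub_le_norm_sub_add_norm_sub y y' ys
    rw [norm_sub_rev y y'] at this
    nlinarith [norm_nonneg (y - ys), sq_nonneg (‖y' - ys‖ - ‖y' - y‖)]
  have hηL' : η * L ≤ 1 / 4 := by
    rw [le_div_iff₀ (by positivity)] at hηL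
    linarith
  have hημ : η * μ ≤ 1 / 4 := (mul_le_mul_of_nonneg_left hμL hη.le).trans hηL'
  have hημ0 : 0 ≤ η * μ := by positivity
  simp only [inner_add_left, inner_sub_left, inner_neg_left, neg_add_rev]
    at s₁ s₂ n₁ n₂ n₃ n₄ n₅ n₆ g₁ g₂
  have q₁ := mul_add_mul_add_le hηL' (norm_nonneg (x' - x)) (norm_nonneg (y' - y))
    (norm_nonneg (x' - x'')) (norm_nonneg (y' - y''))
  have q₂ : 2 * (η * μ) * (‖x' - x‖ ^ 2 + ‖y' - y‖ ^ 2) ≤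
      1 / 2 * (‖x' - x‖ ^ 2 + ‖y' - y‖ ^ 2) :=
    mul_le_mul_of_nonneg_right (by linarith) (by positivity)
  have q₃ : η * μ * (‖x - xs‖ ^ 2 + ‖y - ys‖ ^ 2) ≤ η * μ * (2 * ‖x' - xs‖ ^ 2 +
      2 * ‖x' - x‖ ^ 2 + (2 * ‖y' - ys‖ ^ 2 + 2 * ‖y' - y‖ ^ 2)) :=
    mul_le_mul_of_nonneg_left (by linarith) hημ0
  have w₀ := mul_le_mul_of_nonneg_left hmono (by positivity : 0 ≤ 2 * η)
  have w₁ := mul_le_mul_of_nonneg_left n₁ (by positivity : 0 ≤ 2 * η)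
  have w₂ := mul_le_mul_of_nonneg_left n₂ (by positivity : 0 ≤ 2 * η)
  have w₃ := mul_le_mul_of_nonneg_left n₃ (by positivity : 0 ≤ 2 * η)
  have w₄ := mul_le_mul_of_nonneg_left n₄ (by positivity : 0 ≤ 2 * η)
  have w₅ := mul_le_mul_of_nonneg_left n₅ (by positivity : 0 ≤ 2 * η)
  have w₆ := mul_le_mul_of_nonneg_left n₆ (by positivity : 0 ≤ 2 * η)
  have w₇ := mul_le_mul_of_nonneg_left g₁ (by positivity : 0 ≤ 2 * η)
  have w₈ := mul_le_mul_of_nonneg_left g₂ (by positivity : 0 ≤ 2 * η)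
  linear_combination s₁ + s₂ + w₀ + w₁ + w₂ + w₃ + w₄ + w₅ + w₆ + w₇ + w₈ + q₁ + q₂ + q₃ +
    1 / 2 * sq_nonneg ‖x' - x''‖ + 1 / 2 * sq_nonneg ‖y' - y''‖

end Objective

/-! ### The iterates of the algorithm -/

lemma measurable_trim_received {n m k M : ℕ} {Ξ Ω : Type*} [MeasurableSpace Ξ]
    [MeasurableSpace Ω] {B : Finset (Fin M)} {g : Vec n → Vec m → Ξ → Vec k}
    (hg : Measurable fun p : Vec n × Vec m × Ξ => g p.1 p.2.1 p.2.2)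
    {w : Ω → Vec n × Vec m} (hw : Measurable w) {ξ : Fin M → Ω → Ξ}
    (hξ : ∀ i ∉ B, Measurable (ξ i)) {b : Fin M → Ω → Vec k} (hb : ∀ i ∈ B, Measurable (b i))
    (ε : ℝ) :
    Measurable fun ω => trim ε (received B g (w ω).1 (w ω).2 (fun i => ξ i ω) fun i => b i ω) := by
  refine (WithLp.measurable_toLp 2 _).comp (measurable_pi_lambda _ fun j => ?_)
  refine (measurable_trimmedMean ε).comp (measurable_pi_lambda _ fun i => ?_)
  by_cases hi : i ∈ B
  · simp only [received, if_pos hi]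
    have := hb i hi
    fun_prop
  · simp only [received, if_neg hi]
    have h1 : Measurable fun ω => ((w ω).1, (w ω).2, ξ i ω) :=
      hw.fst.prodMk (hw.snd.prodMk (hξ i hi))
    have := hg.comp h1
    fun_prop

section Iterates

variable {n m M : ℕ} {Ξ : Type*} {X : Set (Vec n)} {Y : Set (Vec m)} {η ε : ℝ}
  {B : Finset (Fin M)} {gx : Vec n → Vec m → Ξ → Vec n} {gy : Vec n → Vec m → Ξ → Vec m}
  {z₁ : Vec n × Vec m}

/-- The mid-point of the iteration that starts from `iterate … t`. -/
noncomputable def midIterate (X : Set (Vec n)) (Y : Set (Vec m)) (η ε : ℝ)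
    (B : Finset (Fin M)) (gx : Vec n → Vec m → Ξ → Vec n) (gy : Vec n → Vec m → Ξ → Vec m)
    (z₁ : Vec n × Vec m) (ξ : ℕ → Fin M → Ξ) (b : ℕ → Fin M → Vec n × Vec m) (t : ℕ) :
    Vec n × Vec m :=
  update X Y η ε B gx gy (iterate X Y η ε B gx gy z₁ ξ b t) (iterate X Y η ε B gx gy z₁ ξ b t)
    (ξ (2 * t)) (b (2 * t))

lemma update_mem (hX : IsCompact X) (hY : IsCompact Y) (hXne : X.Nonempty) (hYne : Y.Nonempty)
    (z w : Vec n × Vec m) (ξ : Fin M → Ξ) (b : Fin M → Vec n × Vec m) :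
    update X Y η ε B gx gy z w ξ b ∈ X ×ˢ Y :=
  ⟨(proj_spec hXne hX _).1, (proj_spec hYne hY _).1⟩

lemma iterate_mem (hX : IsCompact X) (hY : IsCompact Y) (hz : z₁ ∈ X ×ˢ Y) (ξ : ℕ → Fin M → Ξ)
    (b : ℕ → Fin M → Vec n × Vec m) : ∀ t, iterate X Y η ε B gx gy z₁ ξ b t ∈ X ×ˢ Y
  | 0 => hz
  | _ + 1 => update_mem hX hY ⟨_, hz.1⟩ ⟨_, hz.2⟩ _ _ _ _

lemma midIterate_mem (hX : IsCompact X) (hY : IsCompact Y) (hz : z₁ ∈ X ×ˢ Y) (ξ : ℕ → Fin M → Ξ)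
    (b : ℕ → Fin M → Vec n × Vec m) (t : ℕ) :
    midIterate X Y η ε B gx gy z₁ ξ b t ∈ X ×ˢ Y :=
  update_mem hX hY ⟨_, hz.1⟩ ⟨_, hz.2⟩ _ _ _ _

lemma measurable_update [MeasurableSpace Ξ] {Ω : Type*} [MeasurableSpace Ω]
    (hX : Convex ℝ X) (hXc : IsCompact X) (hY : Convex ℝ Y) (hYc : IsCompact Y)
    (hXne : X.Nonempty) (hYne : Y.Nonempty)
    (hgx : Measurable fun p : Vec n × Vec m × Ξ => gx p.1 p.2.1 p.2.2)
    (hgy : Measurable fun p : Vec n × Vec m × Ξ => gy p.1 p.2.1 p.2.2)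
    {z w : Ω → Vec n × Vec m} (hz : Measurable z) (hw : Measurable w) {ξ : Fin M → Ω → Ξ}
    (hξ : ∀ i ∉ B, Measurable (ξ i)) {b : Fin M → Ω → Vec n × Vec m}
    (hb : ∀ i ∈ B, Measurable (b i)) :
    Measurable fun ω => update X Y η ε B gx gy (z ω) (w ω) (fun i => ξ i ω) fun i => b i ω := by
  have h₁ := measurable_trim_received hgx hw hξ (b := fun i ω => (b i ω).1)
    (fun i hi => (hb i hi).fst) ε
  have h₂ := measurable_trim_received hgy hw hξ (b := fun i ω => (b i ω).2)
    (fun i hi => (hb i hi).snd) ε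
  exact ((continuous_proj hXne hXc hX).measurable.comp (hz.fst.sub (h₁.const_smul η))).prodMk
    ((continuous_proj hYne hYc hY).measurable.comp (hz.snd.add (h₂.const_smul η)))

end Iterates

section Execution

variable {n m M R : ℕ} {Ξ Ω : Type*} [MeasurableSpace Ξ] [mΩ : MeasurableSpace Ω]
  {P : Measure Ω} {D : Measure Ξ}
  {X : Set (Vec n)} {Y : Set (Vec m)} {η ε : ℝ}
  {B : Finset (Fin M)} {gx : Vec n → Vec m → Ξ → Vec n} {gy : Vec n → Vec m → Ξ → Vec m}
  {z₁ : Vec n × Vec m} {ℱ : Filtration ℕ mΩ} {ξ : ℕ → Fin M → Ω → Ξ}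
  {b : ℕ → Fin M → Ω → Vec n × Vec m}

/-- The query points are known before the samples of their round are drawn. -/
lemma IsByzantineExecution.measurable_iterate_and_midIterate
    (h : IsByzantineExecution P D B R ℱ ξ b)
    (hX : Convex ℝ X) (hXc : IsCompact X) (hY : Convex ℝ Y) (hYc : IsCompact Y)
    (hz : z₁ ∈ X ×ˢ Y)
    (hgx : Measurable fun p : Vec n × Vec m × Ξ => gx p.1 p.2.1 p.2.2)
    (hgy : Measurable fun p : Vec n × Vec m × Ξ => gy p.1 p.2.1 p.2.2) :
    ∀ t, 2 * t < R →
      Measurable[ℱ (2 * t)] (fun ω => iterate X Y η ε B gx gy z₁ (fun r i => ξ r i ω)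
        (fun r i => b r i ω) t) ∧
      Measurable[ℱ (2 * t + 1)] (fun ω => midIterate X Y η ε B gx gy z₁ (fun r i => ξ r i ω)
        (fun r i => b r i ω) t) := by
  have hXne : X.Nonempty := ⟨_, hz.1⟩
  have hYne : Y.Nonempty := ⟨_, hz.2⟩
  have hmid : ∀ t, 2 * t < R →
      Measurable[ℱ (2 * t)] (fun ω => iterate X Y η ε B gx gy z₁ (fun r i => ξ r i ω)
        (fun r i => b r i ω) t) →
      Measurable[ℱ (2 * t + 1)] (fun ω => midIterate X Y η ε B gx gy z₁ (fun r i => ξ r i ω)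
        (fun r i => b r i ω) t) := fun t ht hm => by
    have hm' := hm.mono (ℱ.mono (Nat.le_succ (2 * t))) le_rfl
    exact @measurable_update n m M Ξ X Y η ε B gx gy _ Ω (ℱ (2 * t + 1)) hX hXc hY hYc hXne hYne
      hgx hgy _ _ hm' hm' _ (h.sample_measurable _ ht) _ (h.message_measurable _ ht)
  intro t
  induction t with
  | zero => exact fun ht => ⟨measurable_const, hmid 0 ht measurable_const⟩
  | succ t ih =>
    intro ht
    obtain ⟨h₁, h₂⟩ := ih (by omega)
    have hr : 2 * t + 1 < R := by omega
    have hle : 2 * t ≤ 2 * t + 1 + 1 := by omega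
    have hz' := h₁.mono (ℱ.mono hle) le_rfl
    have hw' := h₂.mono (ℱ.mono (Nat.le_succ (2 * t + 1))) le_rfl
    have hit : Measurable[ℱ (2 * (t + 1))] (fun ω => iterate X Y η ε B gx gy z₁
        (fun r i => ξ r i ω) (fun r i => b r i ω) (t + 1)) :=
      @measurable_update n m M Ξ X Y η ε B gx gy _ Ω (ℱ (2 * t + 1 + 1)) hX hXc hY hYc hXne hYne
        hgx hgy _ _ hz' hw' _ (h.sample_measurable _ hr) _ (h.message_measurable _ hr)
    exact ⟨hit, hmid (t + 1) ht hit⟩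

/-- The robust gradient of one round is accurate in norm, by a union bound over its coordinates. -/
lemma IsByzantineExecution.measure_norm_dev_le [IsProbabilityMeasure P] [IsProbabilityMeasure D]
    (h : IsByzantineExecution P D B R ℱ ξ b) {k : ℕ} {G : Vec n → Vec m → Vec k}
    {g : Vec n → Vec m → Ξ → Vec k} {σ : Fin k → ℝ} (hg : IsStochasticOracle D X Y G g σ)
    {r : ℕ} (hr : r < R) {w : Ω → Vec n × Vec m} (hw : Measurable[ℱ r] w)
    (hwXY : ∀ ω, w ω ∈ X ×ˢ Y) (c : Fin M → Ω → Vec k) (hM : Even M) (hM0 : 0 < M) {δ : ℝ}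
    (hε : 0 < ε) (hε2 : ε ≤ 1 / 2) (hB : (B.card : ℝ) ≤ ε * (M / 2 : ℕ) / 4) (hδ : 0 < δ)
    (hδ1 : δ ≤ 1) (hK : 12 * Real.log (4 / δ) ≤ ε * (M / 2 : ℕ)) {s : ℝ}
    (hs : √(∑ j, σ j ^ 2) ≤ s) :
    P {ω | 64 * s * √ε < ‖trim ε (received B g (w ω).1 (w ω).2 (fun i => ξ r i ω)
        fun i => c i ω) - G (w ω).1 (w ω).2‖} ≤ ENNReal.ofReal (k * δ) := by
  have hfresh : IndepFun w (fun ω (i : {i : Fin M // i ∉ B}) => ξ r i ω) P :=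
    indep_of_indep_of_le_left (h.sample_fresh r hr) hw.comap_le
  have hcoord := hg.measure_dev_le (hw.mono (ℱ.le r) le_rfl) (fun ω => (hwXY ω).1)
    (fun ω => (hwXY ω).2)
    (fun i hi => (h.sample_measurable r hr i hi).mono (ℱ.le (r + 1)) le_rfl)
    (h.sample_law r hr) (h.sample_indep r hr) hfresh c hM hM0 hε hε2 hB hδ hδ1 hK
  calc P _ ≤ P (⋃ j, {ω | 64 * |σ j| * √ε < |trim ε (received B g (w ω).1 (w ω).2
        (fun i => ξ r i ω) fun i => c i ω) j - G (w ω).1 (w ω).2 j|}) := by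
        refine measure_mono fun ω hω => ?_
        by_contra hcon
        simp only [Set.mem_iUnion, Set.mem_ofPred_eq, not_exists, not_lt] at hcon
        rw [Set.mem_ofPred_eq] at hω
        refine not_le.2 hω ?_
        calc _ ≤ √(∑ j, (64 * |σ j| * √ε) ^ 2) := by
              rw [EuclideanSpace.norm_eq]
              refine Real.sqrt_le_sqrt (Finset.sum_le_sum fun j _ => ?_)
              exact pow_le_pow_left₀ (norm_nonneg _) (hcon j) 2
          _ = 64 * √(∑ j, σ j ^ 2) * √ε := by
              simp only [mul_pow, sq_abs]
              rw [← Finset.sum_mul, ← Finset.mul_sum, Real.sqrt_mul (by positivity),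
                Real.sqrt_mul (by positivity), Real.sqrt_sq (by positivity),
                Real.sqrt_sq (by positivity)]
          _ ≤ 64 * s * √ε := by gcongr
    _ ≤ ∑ j : Fin k, ENNReal.ofReal δ :=
        (measure_iUnion_fintype_le _ _).trans (Finset.sum_le_sum fun j _ => hcoord j)
    _ = ENNReal.ofReal (k * δ) := by
        rw [Finset.sum_const, Finset.card_univ, Fintype.card_fin, nsmul_eq_mul,
          ENNReal.ofReal_mul (by positivity), ENNReal.ofReal_natCast]

end Execution

/-! ### Constants -/

section Constants

variable {α L μ σ D : ℝ} {d T M : ℕ}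

lemma errorFloor_nonneg (hσ : 0 ≤ σ) (hD : 0 ≤ D) (hL : 0 < L) (hμ : 0 < μ) :
    0 ≤ errorFloor σ D (L / μ) L α d T M := by
  unfold errorFloor
  positivity

/-- The trimming parameter is linear in `α` and `log (4 d T²) / M`. -/
lemma sqrt_trimParam_le (hα : 0 ≤ α) (hd : 0 < d) (hT : 0 < T) :
    √(trimParam α (1 / (4 * d * T ^ 2)) M) ≤
      7 * (√α + √(Real.log (4 * d * T ^ 2) / M)) := by
  have hdT : (1 : ℝ) ≤ d * T ^ 2 := by
    have : 1 ≤ d * T ^ 2 := Nat.mul_pos hd (pow_pos hT 2)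
    exact_mod_cast this
  have hl : Real.log 4 ≤ Real.log (4 * d * T ^ 2) :=
    Real.log_le_log (by norm_num) (by linarith)
  have hl4 : 0 ≤ Real.log 4 := Real.log_nonneg (by norm_num)
  have hlog : Real.log (4 / (1 / (4 * d * T ^ 2))) = Real.log 4 + Real.log (4 * d * T ^ 2) := by
    rw [div_div_eq_mul_div, div_one, Real.log_mul (by norm_num) (by nlinarith)]
  unfold trimParam
  rw [hlog]
  set l := Real.log (4 * d * T ^ 2)
  have hlM : 0 ≤ l / M := div_nonneg (by linarith) (by positivity)
  refine Real.sqrt_le_iff.2 ⟨by positivity, ?_⟩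
  have h₁ : (Real.log 4 + l) / M ≤ 2 * (l / M) := by
    rw [← mul_div_assoc]
    gcongr
    linarith
  have h₂ := Real.sq_sqrt hα
  have h₃ := Real.sq_sqrt hlM
  have h₄ : 0 ≤ √α * √(l / M) := by positivity
  nlinarith

end Constants

/-! ### Convergence of the algorithm -/

section Convergence

variable {n m M T : ℕ} {Ξ : Type*} {X : Set (Vec n)} {Y : Set (Vec m)} {f : Vec n → Vec m → ℝ}
  {Gx : Vec n → Vec m → Vec n} {Gy : Vec n → Vec m → Vec m} {L μ η ε Δ D : ℝ}
  {B : Finset (Fin M)} {gx : Vec n → Vec m → Ξ → Vec n} {gy : Vec n → Vec m → Ξ → Vec m}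
  {z₁ : Vec n × Vec m} {ξ : ℕ → Fin M → Ξ} {b : ℕ → Fin M → Vec n × Vec m}

/-- The robust gradients at the query point `w`, computed from the samples `ξ` and the Byzantine
messages `b` of the round, are accurate up to `Δ`. -/
def IsAccurate (Gx : Vec n → Vec m → Vec n) (Gy : Vec n → Vec m → Vec m) (ε Δ : ℝ)
    (B : Finset (Fin M)) (gx : Vec n → Vec m → Ξ → Vec n) (gy : Vec n → Vec m → Ξ → Vec m)
    (w : Vec n × Vec m) (ξ : Fin M → Ξ) (b : Fin M → Vec n × Vec m) : Prop :=
  ‖trim ε (received B gx w.1 w.2 ξ fun i => (b i).1) - Gx w.1 w.2‖ ≤ Δ ∧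
    ‖trim ε (received B gy w.1 w.2 ξ fun i => (b i).2) - Gy w.1 w.2‖ ≤ Δ

/-- Linear convergence to a ball, on the event that all robust gradients are accurate. -/
lemma sq_dist_iterate_le (hX : Convex ℝ X) (hXc : IsCompact X) (hY : Convex ℝ Y)
    (hYc : IsCompact Y) (hLpos : 0 < L) (hL : AreSmooth X Y L Gx Gy) (hμ : 0 < μ) (hμL : μ ≤ L)
    (hf : IsStronglyConvexConcave X Y μ f Gx Gy) {xs : Vec n} {ys : Vec m}
    (hxs : xs ∈ X) (hys : ys ∈ Y) (hsp : IsSaddlePointOn X Y f xs ys) (hz : z₁ ∈ X ×ˢ Y)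
    (hη : 0 < η) (hηL : η ≤ 1 / (4 * L)) (hΔ : 0 ≤ Δ)
    (hDX : ∀ p ∈ X, ∀ q ∈ X, ‖p - q‖ ≤ D) (hDY : ∀ p ∈ Y, ∀ q ∈ Y, ‖p - q‖ ≤ D)
    (hacc : ∀ t < T,
      IsAccurate Gx Gy ε Δ B gx gy (iterate X Y η ε B gx gy z₁ ξ b t) (ξ (2 * t)) (b (2 * t)) ∧
      IsAccurate Gx Gy ε Δ B gx gy (midIterate X Y η ε B gx gy z₁ ξ b t) (ξ (2 * t + 1))
        (b (2 * t + 1))) :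
    ‖xs - (iterate X Y η ε B gx gy z₁ ξ b T).1‖ ^ 2 +
        ‖ys - (iterate X Y η ε B gx gy z₁ ξ b T).2‖ ^ 2 ≤
      2 * Real.exp (-(η * μ * T)) * D ^ 2 + 12 * Δ * D / μ := by
  have hD : 0 ≤ D := (norm_nonneg _).trans (hDX xs hxs xs hxs)
  have hημ : η * μ ≤ 1 / 4 := by
    rw [le_div_iff₀ (by positivity)] at hηL
    nlinarith
  have hrate : 0 ≤ 1 - η * μ := by linarith
  have key : ∀ t ≤ T, ‖xs - (iterate X Y η ε B gx gy z₁ ξ b t).1‖ ^ 2 +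
        ‖ys - (iterate X Y η ε B gx gy z₁ ξ b t).2‖ ^ 2 ≤
      (1 - η * μ) ^ t * (2 * D ^ 2) + 12 * Δ * D / μ := by
    intro t
    induction t with
    | zero =>
      intro _
      have h₁ := pow_le_pow_left₀ (norm_nonneg _) (hDX xs hxs _ hz.1) 2
      have h₂ := pow_le_pow_left₀ (norm_nonneg _) (hDY ys hys _ hz.2) 2
      have h₃ : 0 ≤ 12 * Δ * D / μ := by positivity
      simp only [pow_zero, one_mul, iterate]
      linarith
    | succ t ih =>
      intro ht
      obtain ⟨⟨a₁, a₂⟩, a₃, a₄⟩ := hacc t ht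
      have hmem := iterate_mem (η := η) (ε := ε) (B := B) (gx := gx) (gy := gy) hXc hYc hz ξ b t
      have hstep := extragradient_step hX hXc hY hYc hLpos hL hμ hμL hf hxs hys hsp hmem.1 hmem.2
        hη hηL hDX hDY (x' := (midIterate X Y η ε B gx gy z₁ ξ b t).1)
        (y' := (midIterate X Y η ε B gx gy z₁ ξ b t).2)
        (x'' := (iterate X Y η ε B gx gy z₁ ξ b (t + 1)).1)
        (y'' := (iterate X Y η ε B gx gy z₁ ξ b (t + 1)).2) rfl rfl rfl rfl a₁ a₂ a₃ a₄
      refine hstep.trans ?_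
      have h₁ := mul_le_mul_of_nonneg_left (ih (by omega)) hrate
      have h₂ : (1 - η * μ) * (12 * Δ * D / μ) + 12 * η * Δ * D = 12 * Δ * D / μ := by
        field_simp
        ring
      calc _ ≤ (1 - η * μ) * ((1 - η * μ) ^ t * (2 * D ^ 2) + 12 * Δ * D / μ) +
            12 * η * Δ * D := by linarith
        _ = (1 - η * μ) ^ (t + 1) * (2 * D ^ 2) +
            ((1 - η * μ) * (12 * Δ * D / μ) + 12 * η * Δ * D) := by ring
        _ = _ := by rw [h₂]
  refine (key T le_rfl).trans ?_
  have hexp : (1 - η * μ) ^ T ≤ Real.exp (-(η * μ * T)) := by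
    rw [show -(η * μ * T) = T * -(η * μ) by ring, Real.exp_nat_mul]
    exact pow_le_pow_left₀ hrate (Real.one_sub_le_exp_neg _) T
  have := mul_le_mul_of_nonneg_right hexp (by positivity : 0 ≤ 2 * D ^ 2)
  linarith

end Convergence

section Accuracy

variable {n m M T : ℕ} {Ξ Ω : Type*} [MeasurableSpace Ξ] [mΩ : MeasurableSpace Ω]
  {P : Measure Ω} [IsProbabilityMeasure P] {D : Measure Ξ} [IsProbabilityMeasure D]
  {X : Set (Vec n)} {Y : Set (Vec m)} {Gx : Vec n → Vec m → Vec n} {Gy : Vec n → Vec m → Vec m}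
  {η ε : ℝ}
  {B : Finset (Fin M)} {gx : Vec n → Vec m → Ξ → Vec n} {gy : Vec n → Vec m → Ξ → Vec m}
  {σx : Fin n → ℝ} {σy : Fin m → ℝ}
  {z₁ : Vec n × Vec m} {ℱ : Filtration ℕ mΩ} {ξ : ℕ → Fin M → Ω → Ξ}
  {b : ℕ → Fin M → Ω → Vec n × Vec m}

/-- With probability at least `1 - 2T(n+m)δ`, all robust gradients are accurate. -/
lemma measure_not_accurate_le (h : IsByzantineExecution P D B (2 * T) ℱ ξ b)
    (hX : Convex ℝ X) (hXc : IsCompact X) (hY : Convex ℝ Y) (hYc : IsCompact Y)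
    (hz : z₁ ∈ X ×ˢ Y) (hgx : IsStochasticOracle D X Y Gx gx σx)
    (hgy : IsStochasticOracle D X Y Gy gy σy) (hM : Even M) (hM0 : 0 < M) {δ : ℝ}
    (hε : 0 < ε) (hε2 : ε ≤ 1 / 2) (hB : (B.card : ℝ) ≤ ε * (M / 2 : ℕ) / 4) (hδ : 0 < δ)
    (hδ1 : δ ≤ 1) (hK : 12 * Real.log (4 / δ) ≤ ε * (M / 2 : ℕ)) :
    P {ω | ¬ ∀ t < T,
      IsAccurate Gx Gy ε (64 * noiseLevel σx σy * √ε) B gx gy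
        (iterate X Y η ε B gx gy z₁ (fun r i => ξ r i ω) (fun r i => b r i ω) t)
        (fun i => ξ (2 * t) i ω) (fun i => b (2 * t) i ω) ∧
      IsAccurate Gx Gy ε (64 * noiseLevel σx σy * √ε) B gx gy
        (midIterate X Y η ε B gx gy z₁ (fun r i => ξ r i ω) (fun r i => b r i ω) t)
        (fun i => ξ (2 * t + 1) i ω) (fun i => b (2 * t + 1) i ω)} ≤
      ENNReal.ofReal (T * (2 * (n * δ + m * δ))) := by
  have hround : ∀ r < 2 * T, ∀ w : Ω → Vec n × Vec m, Measurable[ℱ r] w → (∀ ω, w ω ∈ X ×ˢ Y) →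
      P {ω | ¬ IsAccurate Gx Gy ε (64 * noiseLevel σx σy * √ε) B gx gy (w ω)
        (fun i => ξ r i ω) (fun i => b r i ω)} ≤ ENNReal.ofReal (n * δ + m * δ) := by
    intro r hr w hw hwXY
    have hx := h.measure_norm_dev_le hgx hr hw hwXY (fun i ω => (b r i ω).1) hM hM0 hε hε2 hB hδ
      hδ1 hK (le_max_left _ _ : _ ≤ noiseLevel σx σy)
    have hy := h.measure_norm_dev_le hgy hr hw hwXY (fun i ω => (b r i ω).2) hM hM0 hε hε2 hB hδ
      hδ1 hK (le_max_right _ _ : _ ≤ noiseLevel σx σy)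
    rw [ENNReal.ofReal_add (by positivity) (by positivity)]
    refine (measure_mono ?_).trans ((measure_union_le _ _).trans (add_le_add hx hy))
    intro ω hω
    by_contra hcon
    simp only [Set.mem_union, Set.mem_ofPred_eq, not_or, not_lt] at hcon
    exact hω hcon
  have hit := h.measurable_iterate_and_midIterate (η := η) (ε := ε) hX hXc hY hYc hz
    hgx.measurable hgy.measurable
  have hstep : ∀ t ∈ Finset.range T, P {ω | ¬ (IsAccurate Gx Gy ε (64 * noiseLevel σx σy * √ε)
        B gx gy (iterate X Y η ε B gx gy z₁ (fun r i => ξ r i ω) (fun r i => b r i ω) t)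
        (fun i => ξ (2 * t) i ω) (fun i => b (2 * t) i ω) ∧
      IsAccurate Gx Gy ε (64 * noiseLevel σx σy * √ε) B gx gy
        (midIterate X Y η ε B gx gy z₁ (fun r i => ξ r i ω) (fun r i => b r i ω) t)
        (fun i => ξ (2 * t + 1) i ω) (fun i => b (2 * t + 1) i ω))} ≤
      ENNReal.ofReal (2 * (n * δ + m * δ)) := by
    intro t ht
    have ht' := Finset.mem_range.1 ht
    have h₁ := hround (2 * t) (by omega) _ (hit t (by omega)).1
      fun ω => iterate_mem hXc hYc hz _ _ t
    have h₂ := hround (2 * t + 1) (by omega) _ (hit t (by omega)).2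
      fun ω => midIterate_mem hXc hYc hz _ _ t
    rw [two_mul (_ + _), ENNReal.ofReal_add (by positivity) (by positivity)]
    refine (measure_mono ?_).trans ((measure_union_le _ _).trans (add_le_add h₁ h₂))
    intro ω hω
    by_contra hcon
    simp only [Set.mem_union, Set.mem_ofPred_eq, not_or, not_not] at hcon
    exact hω hcon
  rw [ENNReal.ofReal_mul (by positivity), ENNReal.ofReal_natCast, ← nsmul_eq_mul]
  refine le_trans (measure_mono ?_) ((measure_biUnion_finset_le (Finset.range T) _).trans
    ((Finset.sum_le_sum hstep).trans_eq (by simp)))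
  intro ω hω
  by_contra hcon
  simp only [Set.mem_iUnion, Set.mem_ofPred_eq, not_exists, not_not, Finset.mem_range] at hcon
  exact hω hcon

end Accuracy

lemma ofReal_one_sub_le_of_compl {Ω : Type*} [MeasurableSpace Ω] {P : Measure Ω}
    [IsProbabilityMeasure P] {S : Set Ω} {c : ℝ} (hc : 0 ≤ c) (h : P Sᶜ ≤ ENNReal.ofReal c) :
    ENNReal.ofReal (1 - c) ≤ P S := by
  rw [ENNReal.ofReal_sub _ hc, ENNReal.ofReal_one, tsub_le_iff_right]
  calc (1 : ENNReal) = P (S ∪ Sᶜ) := by rw [Set.union_compl_self, measure_univ]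
    _ ≤ P S + P Sᶜ := measure_union_le _ _
    _ ≤ _ := by gcongr

end RDEG

theorem theorem2 :
    ∃ C : ℝ, 0 < C ∧
      ∀ (n m M T : ℕ) (Ξ Ω : Type*) [MeasurableSpace Ξ] [mΩ : MeasurableSpace Ω]
        (P : Measure Ω) [IsProbabilityMeasure P] (𝒟 : Measure Ξ) [IsProbabilityMeasure 𝒟]
        -- the problem
        (X : Set (RDEG.Vec n)) (Y : Set (RDEG.Vec m))
        (f : RDEG.Vec n → RDEG.Vec m → ℝ)
        (Gx : RDEG.Vec n → RDEG.Vec m → RDEG.Vec n)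
        (Gy : RDEG.Vec n → RDEG.Vec m → RDEG.Vec m)
        (L μ : ℝ)
        -- the stochastic oracles
        (gx : RDEG.Vec n → RDEG.Vec m → Ξ → RDEG.Vec n)
        (gy : RDEG.Vec n → RDEG.Vec m → Ξ → RDEG.Vec m)
        (σx : Fin n → ℝ) (σy : Fin m → ℝ)
        -- the Byzantine agents and the execution
        (α : ℝ) (B : Finset (Fin M)) (ℱ : Filtration ℕ mΩ)
        (ξ : ℕ → Fin M → Ω → Ξ) (b : ℕ → Fin M → Ω → RDEG.Vec n × RDEG.Vec m)
        -- the step-size, the confidence level, the initial point and the saddle point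
        (η δ : ℝ) (x₁ xs : RDEG.Vec n) (y₁ ys : RDEG.Vec m),
        Convex ℝ X → IsCompact X → Convex ℝ Y → IsCompact Y →
        x₁ ∈ X → y₁ ∈ Y →
        RDEG.ArePartialGradients X Y f Gx Gy →
        0 < L → RDEG.AreSmooth X Y L Gx Gy →
        0 < μ → RDEG.IsStronglyConvexConcave X Y μ f Gx Gy →
        RDEG.IsStochasticOracle 𝒟 X Y Gx gx σx →
        RDEG.IsStochasticOracle 𝒟 X Y Gy gy σy →
        0 ≤ α → α < 1 / 16 → (B.card : ℝ) ≤ α * M →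
        0 < T → Even M → 48 * Real.log (16 * (max n m : ℕ) * T ^ 2) ≤ M →
        δ = 1 / (4 * (max n m : ℕ) * T ^ 2) →
        RDEG.trimParam α δ M ≤ 1 / 2 →
        RDEG.IsByzantineExecution P 𝒟 B (2 * T) ℱ ξ b →
        0 < η → η ≤ 1 / (4 * L) →
        xs ∈ X → ys ∈ Y → IsSaddlePointOn X Y f xs ys →
        let κ : ℝ := L / μ
        let D : ℝ := max (Metric.diam X) (Metric.diam Y)
        let zT : Ω → RDEG.Vec n × RDEG.Vec m := fun ω =>
          RDEG.iterate X Y η (RDEG.trimParam α δ M) B gx gy (x₁, y₁)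
            (fun r i => ξ r i ω) (fun r i => b r i ω) T
        let err : ℝ := C * RDEG.errorFloor (RDEG.noiseLevel σx σy) D κ L α (max n m) T M
        ENNReal.ofReal (1 - 1 / T) ≤
            P {ω | ‖xs - (zT ω).1‖ ^ 2 + ‖ys - (zT ω).2‖ ^ 2 ≤
              2 * Real.exp (-(η * μ * T)) * D ^ 2 + err} ∧
          (η = 1 / (4 * L) →
            ENNReal.ofReal (1 - 1 / T) ≤
              P {ω | ‖xs - (zT ω).1‖ ^ 2 + ‖ys - (zT ω).2‖ ^ 2 ≤
                2 * Real.exp (-(T / (4 * κ))) * D ^ 2 + err}) := by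
  refine ⟨12 * 64 * 7, by norm_num, ?_⟩
  intro n m M T Ξ Ω _ mΩ P _ 𝒟 _ X Y f Gx Gy L μ gx gy σx σy α B ℱ ξ b η δ x₁ xs y₁ ys
    hX hXc hY hYc hx₁ hy₁ _ hL hsm hμ hf hgx hgy hα _ hB hT hM hM48 hδ hε2 hexec hη hηL hxs hys
    hsp κ D zT err
  have hz : (x₁, y₁) ∈ X ×ˢ Y := ⟨hx₁, hy₁⟩
  have hmem : ∀ ω, zT ω ∈ X ×ˢ Y := fun ω => RDEG.iterate_mem hXc hYc hz _ _ T
  have hD : 0 ≤ D := Metric.diam_nonneg.trans (le_max_left _ _)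
  have hσ : 0 ≤ RDEG.noiseLevel σx σy := (Real.sqrt_nonneg _).trans (le_max_left _ _)
  have herr : 0 ≤ err := mul_nonneg (by norm_num) (RDEG.errorFloor_nonneg hσ hD hL hμ)
  have hT1 : (1 : ℝ) ≤ T := by exact_mod_cast hT
  -- the second claim is the first one, rewritten for the largest step-size
  suffices hmain : ENNReal.ofReal (1 - 1 / T) ≤
      P {ω | ‖xs - (zT ω).1‖ ^ 2 + ‖ys - (zT ω).2‖ ^ 2 ≤
        2 * Real.exp (-(η * μ * T)) * D ^ 2 + err} by
    refine ⟨hmain, fun hη' => ?_⟩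
    have e : (T : ℝ) / (4 * κ) = η * μ * T := by
      rw [hη']
      simp only [κ]
      field_simp
    rw [e]
    exact hmain
  by_cases hsingle : ∀ x ∈ X, ∀ y ∈ Y, xs = x ∧ ys = y
  · -- on a single point there is nothing to show, whatever the algorithm does
    have huniv : {ω | ‖xs - (zT ω).1‖ ^ 2 + ‖ys - (zT ω).2‖ ^ 2 ≤
        2 * Real.exp (-(η * μ * T)) * D ^ 2 + err} = Set.univ := by
      refine Set.eq_univ_of_forall fun ω => ?_
      obtain ⟨e₁, e₂⟩ := hsingle _ (hmem ω).1 _ (hmem ω).2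
      rw [Set.mem_ofPred_eq, ← e₁, ← e₂]
      simp only [sub_self, norm_zero]
      have : 0 ≤ 2 * Real.exp (-(η * μ * T)) * D ^ 2 := by positivity
      linarith
    rw [huniv, measure_univ]
    exact ENNReal.ofReal_le_one.2 (by linarith [show (0 : ℝ) ≤ 1 / T by positivity])
  obtain ⟨x, hx, y, hy, hne⟩ : ∃ x ∈ X, ∃ y ∈ Y, xs ≠ x ∨ ys ≠ y := by
    by_contra! hcon
    exact hsingle hcon
  have hμL : μ ≤ L := hf.le_smoothness hsm hxs hx hys hy hne
  have hd : 0 < max n m := by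
    by_contra! hcon
    obtain rfl : n = 0 := by omega
    obtain rfl : m = 0 := by omega
    exact hne.elim (fun h => h (Subsingleton.elim _ _)) fun h => h (Subsingleton.elim _ _)
  have hd1 : (1 : ℝ) ≤ (max n m : ℕ) := by exact_mod_cast hd
  have hdT : (1 : ℝ) ≤ (max n m : ℕ) * T ^ 2 := by
    have : (1 : ℝ) ≤ T ^ 2 := one_le_pow₀ hT1
    nlinarith
  have hδ0 : 0 < δ := by rw [hδ]; exact div_pos one_pos (by linarith)
  have hδ1 : δ ≤ 1 := by rw [hδ, div_le_one (by linarith)]; linarith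
  have hlogpos : 0 < Real.log (16 * (max n m : ℕ) * T ^ 2) := Real.log_pos (by linarith)
  have hM0' : (0 : ℝ) < M := lt_of_lt_of_le (by positivity) hM48
  have hM0 : 0 < M := by exact_mod_cast hM0'
  have hlog4 : 0 < Real.log (4 / δ) := Real.log_pos ((one_lt_div hδ0).2 (by linarith))
  set ε := RDEG.trimParam α δ M with hεdef
  have hε : 0 < ε := by
    rw [hεdef, RDEG.trimParam]
    positivity
  have hεN : ε * (M / 2 : ℕ) = 4 * α * M + 12 * Real.log (4 / δ) := by
    rw [RDEG.cast_half hM, hεdef, RDEG.trimParam]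
    field_simp
    ring
  have hαM : 0 ≤ α * M := by positivity
  have hacc := RDEG.measure_not_accurate_le (η := η) hexec hX hXc hY hYc hz hgx hgy hM hM0 hε hε2
    (by rw [hεN]; linarith) hδ0 hδ1 (by rw [hεN]; linarith)
  refine RDEG.ofReal_one_sub_le_of_compl (by positivity)
    ((measure_mono (Set.compl_subset_comm.1 fun ω hω => ?_)).trans
      (hacc.trans (ENNReal.ofReal_le_ofReal ?_)))
  · rw [Set.mem_compl_iff, Set.mem_ofPred_eq, not_not] at hω
    have hfin := RDEG.sq_dist_iterate_le (D := D) hX hXc hY hYc hL hsm hμ hμL hf hxs hys hsp hz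
      hη hηL (by positivity)
      (fun p hp q hq => by
        rw [← dist_eq_norm]
        exact (Metric.dist_le_diam_of_mem hXc.isBounded hp hq).trans (le_max_left _ _))
      (fun p hp q hq => by
        rw [← dist_eq_norm]
        exact (Metric.dist_le_diam_of_mem hYc.isBounded hp hq).trans (le_max_right _ _)) hω
    refine hfin.trans (add_le_add le_rfl ?_)
    have hsqrt := RDEG.sqrt_trimParam_le (M := M) hα hd hT
    rw [← hδ, ← hεdef] at hsqrt
    have e : err = 12 * (64 * RDEG.noiseLevel σx σy *
        (7 * (√α + √(Real.log (4 * (max n m : ℕ) * T ^ 2) / M)))) * D / μ := by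
      simp only [err, κ, RDEG.errorFloor]
      field_simp
    rw [e]
    gcongr
  · have hn : (n : ℝ) ≤ (max n m : ℕ) := by exact_mod_cast le_max_left n m
    have hm : (m : ℝ) ≤ (max n m : ℕ) := by exact_mod_cast le_max_right n m
    calc T * (2 * (n * δ + m * δ))
        ≤ T * (2 * ((max n m : ℕ) * δ + (max n m : ℕ) * δ)) := by gcongr
      _ = 1 / T := by
        rw [hδ]
        field_simp
        norm_num
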